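/- **Definitions.** Let $\mathcal C$ be a symmetric monoidal category with unit $I$ (coherence isomorphisms of $\mathcal C$ are suppressed below). *Learners.* $\mathbf{Learn}_{\mathcal C}$ is the symmetric monoidal category whose objects are pairs $(A,A')$ of objects of $\mathcal C$ and whose morphisms $(A,A')\to(B,B')$ are the elements of the coend $$\int^{P,Q\in\mathcal C}\mathcal C(P\otimes A,\,Q\otimes B)\times\mathcal C(Q\otimes B',\,P\otimes A').$$ The class of $(l,r)$ is written $(l\mid r)$; thus $(l\circ(p\otimes A)\mid r\circ(q\otimes B'))=((q\otimes B)\circ l\mid (p\otimes A')\circ r)$ for all $p:P\to P'$, $q:Q\to Q'$, $l:P'\otimes A\to Q\otimes B$, $r:Q'\otimes B'\to P\otimes A'$. The identity is $(\mathrm{id}_{I\otimes A}\mid\mathrm{id}_{I\otimes A'})$. The composite of $(l_1\mid r_1):(A,A')\to(B,B')$ and $(l_2\mid r_2):(B,B')\to(D,D')$ has residuals $P_2\otimes P_1$ and $Q_1\otimes Q_2$; its left component applies $l_1$ on $P_1\otimes A$, swaps $P_2$ past $Q_1$, and applies $l_2$ on $P_2\otimes B$, and its right component is formed in the same way from $r_2$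 followed by $r_1$. The tensor product is $(A,A')\otimes(B,B')=(A\otimes B,\,B'\otimes A')$ on objects, and on morphisms places the left components, respectively the right components, side by side, using symmetries of $\mathcal C$ to rearrange the wires. The unit is $(I,I)$, and the structure morphisms, including the symmetry, are the images of those of $\mathcal C\times\mathcal C^{\mathrm{op}}$ under $(f,g)\mapsto(I\otimes f\mid I\otimes g)$. *Atemporal learners.* Put $(A,A')^*=(A',A)$. Let $\eta:(I,I)\to(A,A')\otimes(A,A')^*$ be the learner with $P=A\otimes A'$, $Q=I$, and let $\varepsilon:(A,A')^*\otimes(A,A')\to(I,I)$ be the learner with $P=I$, $Q=A'\otimes A$, the components of both being coherence isomorphisms built from unitors. $\mathbf{Atemp}_{\mathcal C}$ is the symmetric monoidal category obtained as the quotient of $\mathbf{Learn}_{\mathcal C}$ by the smallest congruence (stable under composition and under $\otimes$) that identifies, for each object $X=(A,A')$, the snake $$X\cong I\otimes X\xrightarrow{\eta\otimes X}(X\otimes X^*)\otimes X\cong X\otimes(X^*\otimes X)\xrightarrow{X\otimes\varepsilon}X\otimes I\cong X$$ with $\mathrm{id}_X$. Let $\iota:\mathcal C\to\mathbf{Atemp}_{\mathcal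 C}$ be the symmetric monoidal functor with $\iota A=(A,I)$ and $\iota(f:A\to B)=(I\otimes f\mid\mathrm{id}_{I\otimes I})$. **Theorem.** Let $\mathcal C$ be a symmetric monoidal category, $\mathcal D$ a compact closed category (a symmetric monoidal category in which every object $X$ has a chosen dual $X^*$, with $\eta_X:I\to X\otimes X^*$ and $\varepsilon_X:X^*\otimes X\to I$ satisfying the snake equations), and $F:\mathcal C\to\mathcal D$ a (strong) symmetric monoidal functor. Then there is a (strong) symmetric monoidal functor $\hat F:\mathbf{Atemp}_{\mathcal C}\to\mathcal D$ such that: 1. on objects, $\hat F(A,A')=(FA')^*\otimes FA$; 2. on morphisms, for all $l:P\otimes A\to Q\otimes B$ and $r:Q\otimes B'\to P\otimes A'$, $\hat F(l\mid r)$ is the composite $$(FA')^*\otimes FA\to(FA')^*\otimes(FP)^*\otimes FP\otimes FA\xrightarrow{\ \bar r^{\,*}\otimes\bar l\ }(FB')^*\otimes(FQ)^*\otimes FQ\otimes FB\to(FB')^*\otimes FB ,$$ where the first map inserts $I\xrightarrow{\eta_{FP}}FP\otimes(FP)^*\cong(FP)^*\otimes FP$ (the isomorphism being the symmetry), the last map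 applies $\varepsilon_{FQ}$, the map $\bar l:FP\otimes FA\to FQ\otimes FB$ is $F l$ conjugated by the structure isomorphisms of $F$, and $\bar r^{\,*}:(FA')^*\otimes(FP)^*\to(FB')^*\otimes(FQ)^*$ is the dual of the similarly conjugated $\bar r:FQ\otimes FB'\to FP\otimes FA'$, with $Y^*\otimes X^*$ as the dual of $X\otimes Y$; 3. $F$ factors through $\iota$: there is a monoidal natural isomorphism $\hat F\circ\iota\cong F$. -/

import Mathlib

set_option linter.unusedSectionVars false
open CategoryTheory MonoidalCategory

universe v u v₁ v₂ u₁ u₂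

/-! Operations on cells `P ⊗ A ⟶ Q ⊗ B`, the components of learners. -/

namespace Cell

variable {C : Type u} [Category.{v} C] [MonoidalCategory C] [SymmetricCategory C]

/-- Adds a wire `X` to the left of a cell. -/
def lwhisker (X : C) {P A Q B : C} (l : P ⊗ A ⟶ Q ⊗ B) : (X ⊗ P) ⊗ A ⟶ (X ⊗ Q) ⊗ B :=
  (α_ X P A).hom ≫ X ◁ l ≫ (α_ X Q B).inv

/-- Composition of cells: on `P₂`, `P₁`, `A` apply `l₁` to `P₁ ⊗ A`, swap `P₂` past `Q₁` and
apply `l₂` to `P₂ ⊗ B`. -/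
def comp {P₁ A Q₁ B P₂ Q₂ D : C} (l₁ : P₁ ⊗ A ⟶ Q₁ ⊗ B) (l₂ : P₂ ⊗ B ⟶ Q₂ ⊗ D) :
    (P₂ ⊗ P₁) ⊗ A ⟶ (Q₁ ⊗ Q₂) ⊗ D :=
  lwhisker P₂ l₁ ≫ (β_ P₂ Q₁).hom ▷ B ≫ lwhisker Q₁ l₂

/-- Side-by-side tensor of cells: interchange the middle wires, apply `l ⊗ m`, and interchange
the middle wires back. -/
def tens {P A Q B P' A' Q' B' : C} (l : P ⊗ A ⟶ Q ⊗ B) (m : P' ⊗ A' ⟶ Q' ⊗ B') :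
    (P ⊗ P') ⊗ (A ⊗ A') ⟶ (Q ⊗ Q') ⊗ (B ⊗ B') :=
  tensorμ P P' A A' ≫ (l ⊗ₘ m) ≫ tensorδ Q Q' B B'

@[simp]
lemma lwhisker_whisker (X : C) {P Q : C} (p : P ⟶ Q) (A : C) :
    lwhisker X (p ▷ A) = (X ◁ p) ▷ A := by simp [lwhisker]

@[simp]
lemma lwhisker_comp (X : C) {P A Q B R D : C} (l : P ⊗ A ⟶ Q ⊗ B) (m : Q ⊗ B ⟶ R ⊗ D) :
    lwhisker X (l ≫ m) = lwhisker X l ≫ lwhisker X m := by simp [lwhisker]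

lemma whisker_lwhisker {X Y : C} (x : X ⟶ Y) {P A Q B : C} (l : P ⊗ A ⟶ Q ⊗ B) :
    (x ▷ P) ▷ A ≫ lwhisker Y l = lwhisker X l ≫ (x ▷ Q) ▷ B := by
  simp only [lwhisker, Category.assoc, ← associator_inv_naturality_left, whisker_exchange_assoc,
    associator_naturality_left_assoc]

lemma lwhisker_tensor (X Y : C) {P A Q B : C} (l : P ⊗ A ⟶ Q ⊗ B) :
    lwhisker X (lwhisker Y l) ≫ (α_ X Y Q).inv ▷ B = (α_ X Y P).inv ▷ A ≫ lwhisker (X ⊗ Y) l := by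
  simp only [lwhisker]; monoidal

lemma lwhisker_unit {P A Q B : C} (l : P ⊗ A ⟶ Q ⊗ B) :
    lwhisker (𝟙_ C) l ≫ (λ_ Q).hom ▷ B = (λ_ P).hom ▷ A ≫ l := by
  simp only [lwhisker]; monoidal

lemma comp_slide_left {P P' A Q B P₂ Q₂ D : C} (p : P ⟶ P') (l : P' ⊗ A ⟶ Q ⊗ B)
    (m : P₂ ⊗ B ⟶ Q₂ ⊗ D) : comp (p ▷ A ≫ l) m = (P₂ ◁ p) ▷ A ≫ comp l m := by
  simp [comp]

lemma comp_slide_right {P A Q Q' B P₂ Q₂ D : C} (q : Q ⟶ Q') (l : P ⊗ A ⟶ Q ⊗ B)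
    (m : P₂ ⊗ B ⟶ Q₂ ⊗ D) : comp (l ≫ q ▷ B) m = comp l m ≫ (q ▷ Q₂) ▷ D := by
  simp only [comp, lwhisker_comp, lwhisker_whisker, Category.assoc, ← whisker_lwhisker,
    ← comp_whiskerRight_assoc, BraidedCategory.braiding_naturality_right]

lemma comp_slide_left' {P P' A Q B P₁ Q₁ D : C} (p : P ⟶ P') (l : P₁ ⊗ D ⟶ Q₁ ⊗ A)
    (m : P' ⊗ A ⟶ Q ⊗ B) : comp l (p ▷ A ≫ m) = (p ▷ P₁) ▷ D ≫ comp l m := by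
  simp only [comp, lwhisker_comp, lwhisker_whisker, reassoc_of% @whisker_lwhisker,
    ← comp_whiskerRight_assoc, BraidedCategory.braiding_naturality_left]

lemma comp_slide_right' {P A Q Q' B P₁ Q₁ D : C} (q : Q ⟶ Q') (l : P₁ ⊗ D ⟶ Q₁ ⊗ A)
    (m : P ⊗ A ⟶ Q ⊗ B) : comp l (m ≫ q ▷ B) = comp l m ≫ (Q₁ ◁ q) ▷ B := by
  simp [comp]

lemma comp_wire {P A Q B B' P₂ Q₂ D : C} (l : P ⊗ A ⟶ Q ⊗ B) (f : B ⟶ B')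
    (m : P₂ ⊗ B' ⟶ Q₂ ⊗ D) : comp (l ≫ Q ◁ f) m = comp l (P₂ ◁ f ≫ m) := by
  simp only [comp, lwhisker, comp_whiskerRight, MonoidalCategory.whiskerLeft_comp, Category.assoc,
    Iso.inv_hom_id_assoc]
  congr 2
  rw [associator_inv_naturality_right_assoc, whisker_exchange_assoc,
    associator_naturality_right_assoc]

lemma wire_comp {P A A' Q B P₂ Q₂ D : C} (f : A ⟶ A') (l : P ⊗ A' ⟶ Q ⊗ B)
    (m : P₂ ⊗ B ⟶ Q₂ ⊗ D) : comp (P ◁ f ≫ l) m = (P₂ ⊗ P) ◁ f ≫ comp l m := by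
  simp [comp, lwhisker]

lemma comp_wire' {P A Q B P₂ Q₂ D D' : C} (l : P ⊗ A ⟶ Q ⊗ B)
    (m : P₂ ⊗ B ⟶ Q₂ ⊗ D) (f : D ⟶ D') : comp l (m ≫ Q₂ ◁ f) = comp l m ≫ (Q ⊗ Q₂) ◁ f := by
  simp [comp, lwhisker]

lemma comp_assoc {P₁ A Q₁ B P₂ Q₂ D P₃ Q₃ E : C} (l₁ : P₁ ⊗ A ⟶ Q₁ ⊗ B)
    (l₂ : P₂ ⊗ B ⟶ Q₂ ⊗ D) (l₃ : P₃ ⊗ D ⟶ Q₃ ⊗ E) :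
    comp (comp l₁ l₂) l₃ ≫ (α_ _ _ _).hom ▷ _ = (α_ _ _ _).inv ▷ _ ≫ comp l₁ (comp l₂ l₃) := by
  simp only [comp, lwhisker, BraidedCategory.braiding_tensor_left_hom,
    BraidedCategory.braiding_tensor_right_hom]
  calc
    _ = 𝟙 _ ⊗≫ P₃ ◁ P₂ ◁ l₁ ⊗≫ P₃ ◁ (β_ P₂ Q₁).hom ▷ B ⊗≫
          ((P₃ ⊗ Q₁) ◁ l₂ ≫ (β_ P₃ Q₁).hom ▷ (Q₂ ⊗ D)) ⊗≫
          Q₁ ◁ (β_ P₃ Q₂).hom ▷ D ⊗≫ Q₁ ◁ Q₂ ◁ l₃ ⊗≫ 𝟙 _ := by monoidal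
    _ = _ := by rw [whisker_exchange]; monoidal

lemma id_comp' {P A Q B : C} (l : P ⊗ A ⟶ Q ⊗ B) :
    comp (𝟙 (𝟙_ C ⊗ A)) l = (ρ_ P).hom ▷ A ≫ l ≫ (λ_ Q).inv ▷ B := by
  have := lwhisker_unit l
  rw [← cancel_mono ((λ_ Q).hom ▷ B)]
  simp [comp, lwhisker_unit]
  simp [lwhisker]

lemma comp_id' {P A Q B : C} (l : P ⊗ A ⟶ Q ⊗ B) :
    comp l (𝟙 (𝟙_ C ⊗ B)) = (λ_ P).hom ▷ A ≫ l ≫ (ρ_ Q).inv ▷ B := by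
  rw [← reassoc_of% @lwhisker_unit]
  simp [comp, lwhisker]


lemma tensorμ_braiding (X Y P R : C) :
    tensorμ X Y P R ≫ ((β_ X P).hom ⊗ₘ (β_ Y R).hom) = (β_ (X ⊗ Y) (P ⊗ R)).hom ≫ tensorμ P R X Y := by
  simp only [tensorμ, BraidedCategory.braiding_tensor_left_hom,
    BraidedCategory.braiding_tensor_right_hom]
  symm
  calc
    _ = 𝟙 _ ⊗≫ X ◁ (β_ Y P).hom ▷ R ⊗≫ ((β_ X P).hom ▷ (Y ⊗ R) ≫ (P ⊗ X) ◁ (β_ Y R).hom) ⊗≫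
          P ◁ ((β_ X R).hom ≫ (β_ R X).hom) ▷ Y ⊗≫ 𝟙 _ := by monoidal
    _ = _ := by rw [SymmetricCategory.symmetry, MonoidalCategory.tensorHom_def]; monoidal


lemma tens_whisker {P Q P' Q' : C} (p : P ⟶ Q) (p' : P' ⟶ Q') (A A' : C) :
    tens (p ▷ A) (p' ▷ A') = (p ⊗ₘ p') ▷ (A ⊗ A') := by
  simp [tens, ← tensorμ_natural_left_assoc]

lemma tens_wire {A B A' B' : C} (P P' : C) (p : A ⟶ B) (p' : A' ⟶ B')  :
    tens (P ◁ p) (P' ◁ p') = (P ⊗ P') ◁ (p ⊗ₘ p') := by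
  simp [tens, ← tensorμ_natural_right_assoc]

lemma tens_comp {P A Q B R D P' A' Q' B' R' D' : C} (l : P ⊗ A ⟶ Q ⊗ B) (m : P' ⊗ A' ⟶ Q' ⊗ B')
    (l₂ : Q ⊗ B ⟶ R ⊗ D) (m₂ : Q' ⊗ B' ⟶ R' ⊗ D') :
    tens (l ≫ l₂) (m ≫ m₂) = tens l m ≫ tens l₂ m₂ := by
  simp [tens]

instance (X Y Z W : C) : IsIso (tensorμ X Y Z W) := ⟨tensorδ X Y Z W, by simp, by simp⟩

lemma tens_tensorμ {P A Q B P' A' Q' B' : C} (l : P ⊗ A ⟶ Q ⊗ B) (m : P' ⊗ A' ⟶ Q' ⊗ B') :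
    tens l m ≫ tensorμ Q Q' B B' = tensorμ P P' A A' ≫ (l ⊗ₘ m) := by
  simp [tens]

lemma tens_lwhisker (X Y : C) {P A Q B P' A' Q' B' : C} (l : P ⊗ A ⟶ Q ⊗ B)
    (m : P' ⊗ A' ⟶ Q' ⊗ B') :
    tensorμ X Y P P' ▷ (A ⊗ A') ≫ tens (lwhisker X l) (lwhisker Y m) =
      lwhisker (X ⊗ Y) (tens l m) ≫ tensorμ X Y Q Q' ▷ (B ⊗ B') := by
  simp only [tens, lwhisker]
  have h1 := tensor_associativity X Y P P' A A'
  have h2 := tensor_associativity X Y Q Q' B B'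
  have h3 : tensorμ X Y (Q ⊗ B) (Q' ⊗ B') ≫ ((α_ X Q B).inv ⊗ₘ (α_ Y Q' B').inv) ≫
      tensorδ (X ⊗ Q) (Y ⊗ Q') B B' = (X ⊗ Y) ◁ tensorδ Q Q' B B' ≫
        (α_ (X ⊗ Y) (Q ⊗ Q') (B ⊗ B')).inv ≫ tensorμ X Y Q Q' ▷ (B ⊗ B') := by
    rw [← cancel_mono (tensorμ (X ⊗ Q) (Y ⊗ Q') B B'),
      ← cancel_mono ((α_ X Q B).hom ⊗ₘ (α_ Y Q' B').hom)]
    simp only [Category.assoc, h2, tensorδ_tensorμ_assoc, tensorHom_comp_tensorHom, Iso.inv_hom_id,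
      Iso.inv_hom_id_assoc, ← MonoidalCategory.whiskerLeft_comp_assoc, tensorδ_tensorμ]
    simp
  simp only [← tensorHom_comp_tensorHom, Category.assoc, MonoidalCategory.whiskerLeft_comp]
  rw [reassoc_of% h1, ← tensorμ_natural_right_assoc, h3]

lemma tens_compCell {P₁ A Q₁ B P₂ Q₂ D P₁' A' Q₁' B' P₂' Q₂' D' : C} (l₁ : P₁ ⊗ A ⟶ Q₁ ⊗ B)
    (l₂ : P₂ ⊗ B ⟶ Q₂ ⊗ D) (m₁ : P₁' ⊗ A' ⟶ Q₁' ⊗ B') (m₂ : P₂' ⊗ B' ⟶ Q₂' ⊗ D') :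
    tensorμ P₂ P₂' P₁ P₁' ▷ (A ⊗ A') ≫ tens (comp l₁ l₂) (comp m₁ m₂) =
      comp (tens l₁ m₁) (tens l₂ m₂) ≫ tensorμ Q₁ Q₁' Q₂ Q₂' ▷ (D ⊗ D') := by
  simp only [comp, tens_comp, reassoc_of% @tens_lwhisker, tens_whisker, Category.assoc, tens_lwhisker]
  simp only [← comp_whiskerRight_assoc, tensorμ_braiding]
  simp only [comp_whiskerRight, Category.assoc, tens_lwhisker]


lemma tensorμ_swap (X Y P R : C) :
    tensorμ X Y P R ≫ (β_ (X ⊗ P) (Y ⊗ R)).hom =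
      ((β_ X Y).hom ⊗ₘ (β_ P R).hom) ≫ tensorμ Y X R P := by
  simp only [tensorμ, BraidedCategory.braiding_tensor_left_hom,
    BraidedCategory.braiding_tensor_right_hom]
  calc
    _ = 𝟙 _ ⊗≫ X ◁ ((β_ Y P).hom ≫ (β_ P Y).hom) ▷ R ⊗≫
          ((β_ X Y).hom ▷ (P ⊗ R) ≫ (Y ⊗ X) ◁ (β_ P R).hom) ⊗≫
          Y ◁ (β_ X R).hom ▷ P ⊗≫ 𝟙 _ := by monoidal
    _ = _ := by rw [SymmetricCategory.symmetry, MonoidalCategory.tensorHom_def]; monoidal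

lemma tens_assoc {P A Q B P' A' Q' B' P'' A'' Q'' B'' : C} (l : P ⊗ A ⟶ Q ⊗ B)
    (m : P' ⊗ A' ⟶ Q' ⊗ B') (n : P'' ⊗ A'' ⟶ Q'' ⊗ B'') :
    tens (tens l m) n ≫ ((α_ Q Q' Q'').hom ⊗ₘ (α_ B B' B'').hom) =
      ((α_ P P' P'').hom ⊗ₘ (α_ A A' A'').hom) ≫ tens l (tens m n) := by
  rw [← cancel_mono (tensorμ Q (Q' ⊗ Q'') B (B' ⊗ B'')),
    ← cancel_mono ((Q ⊗ B) ◁ tensorμ Q' Q'' B' B'')]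
  simp only [Category.assoc]
  rw [← associator_monoidal, reassoc_of% @tens_tensorμ, reassoc_of% @tens_tensorμ, ← tensorHom_id,
    tensorHom_comp_tensorHom_assoc, tens_tensorμ, Category.comp_id, ← id_tensorHom,
    tensorHom_comp_tensorHom, tens_tensorμ, Category.comp_id]
  have h1 := associator_monoidal_assoc P P' P'' A A' A'' (l ⊗ₘ m ⊗ₘ n)
  rw [← id_tensorHom, tensorHom_comp_tensorHom, Category.id_comp, ← tensorHom_id,
    ← associator_naturality, tensorHom_comp_tensorHom_assoc, Category.id_comp] at h1
  exact h1

lemma tens_leftUnitor {P A Q B : C} (l : P ⊗ A ⟶ Q ⊗ B) :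
    tens (𝟙 (𝟙_ C ⊗ 𝟙_ C)) l ≫ ((λ_ Q).hom ⊗ₘ (λ_ B).hom) = ((λ_ P).hom ⊗ₘ (λ_ A).hom) ≫ l := by
  simp only [leftUnitor_monoidal, reassoc_of% @tens_tensorμ, Category.assoc]
  simp only [id_tensorHom, whisker_exchange_assoc, leftUnitor_naturality]

lemma tens_rightUnitor {P A Q B : C} (l : P ⊗ A ⟶ Q ⊗ B) :
    tens l (𝟙 (𝟙_ C ⊗ 𝟙_ C)) ≫ ((ρ_ Q).hom ⊗ₘ (ρ_ B).hom) = ((ρ_ P).hom ⊗ₘ (ρ_ A).hom) ≫ l := by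
  simp only [rightUnitor_monoidal, reassoc_of% @tens_tensorμ, Category.assoc]
  simp only [tensorHom_id, ← whisker_exchange_assoc, rightUnitor_naturality]

lemma tens_braiding {P A Q B P' A' Q' B' : C} (l : P ⊗ A ⟶ Q ⊗ B) (m : P' ⊗ A' ⟶ Q' ⊗ B') :
    tens l m ≫ ((β_ Q Q').hom ⊗ₘ (β_ B B').hom) =
      ((β_ P P').hom ⊗ₘ (β_ A A').hom) ≫ tens m l := by
  rw [← cancel_mono (tensorμ Q' Q B' B), Category.assoc, Category.assoc, ← tensorμ_swap,
    reassoc_of% @tens_tensorμ, tens_tensorμ, BraidedCategory.braiding_naturality, reassoc_of% @tensorμ_swap]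

/-- The switched tensor of cells: residuals in the order `P`, `P'`, the other wires in the
order `A'`, `A`. -/
def tensSwap {P A Q B P' A' Q' B' : C} (l : P ⊗ A ⟶ Q ⊗ B) (m : P' ⊗ A' ⟶ Q' ⊗ B') :
    (P ⊗ P') ⊗ (A' ⊗ A) ⟶ (Q ⊗ Q') ⊗ (B' ⊗ B) :=
  (P ⊗ P') ◁ (β_ A' A).hom ≫ tens l m ≫ (Q ⊗ Q') ◁ (β_ B B').hom

lemma tens_slide {P₁ P A Q Q₁ B P₁' P' A' Q' Q₁' B' : C} (p : P₁ ⟶ P) (l : P ⊗ A ⟶ Q ⊗ B)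
    (q : Q ⟶ Q₁) (p' : P₁' ⟶ P') (m : P' ⊗ A' ⟶ Q' ⊗ B') (q' : Q' ⟶ Q₁') :
    tens (p ▷ A ≫ l ≫ q ▷ B) (p' ▷ A' ≫ m ≫ q' ▷ B') =
      (p ⊗ₘ p') ▷ (A ⊗ A') ≫ tens l m ≫ (q ⊗ₘ q') ▷ (B ⊗ B') := by
  simp only [tens_comp, tens_whisker]

lemma tensSwap_slide {P₁ P A Q Q₁ B P₁' P' A' Q' Q₁' B' : C} (p : P₁ ⟶ P) (l : P ⊗ A ⟶ Q ⊗ B)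
    (q : Q ⟶ Q₁) (p' : P₁' ⟶ P') (m : P' ⊗ A' ⟶ Q' ⊗ B') (q' : Q' ⟶ Q₁') :
    tensSwap (p ▷ A ≫ l ≫ q ▷ B) (p' ▷ A' ≫ m ≫ q' ▷ B') =
      (p ⊗ₘ p') ▷ (A' ⊗ A) ≫ tensSwap l m ≫ (q ⊗ₘ q') ▷ (B' ⊗ B) := by
  simp only [tensSwap, tens_slide, Category.assoc, whisker_exchange, whisker_exchange_assoc]

lemma tensSwap_wire {A B A' B' : C} (P P' : C) (f : A ⟶ B) (f' : A' ⟶ B')  :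
    tensSwap (P ◁ f) (P' ◁ f') = (P ⊗ P') ◁ (f' ⊗ₘ f) := by
  simp only [tensSwap, tens_wire, ← MonoidalCategory.whiskerLeft_comp,
    BraidedCategory.braiding_naturality, SymmetricCategory.symmetry_assoc]

lemma tensSwap_compCell {P₁ A Q₁ B P₂ Q₂ D P₁' A' Q₁' B' P₂' Q₂' D' : C} (l₁ : P₁ ⊗ A ⟶ Q₁ ⊗ B)
    (l₂ : P₂ ⊗ B ⟶ Q₂ ⊗ D) (m₁ : P₁' ⊗ A' ⟶ Q₁' ⊗ B') (m₂ : P₂' ⊗ B' ⟶ Q₂' ⊗ D') :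
    tensorμ P₂ P₂' P₁ P₁' ▷ (A' ⊗ A) ≫ tensSwap (comp l₁ l₂) (comp m₁ m₂) =
      comp (tensSwap l₁ m₁) (tensSwap l₂ m₂) ≫ tensorμ Q₁ Q₁' Q₂ Q₂' ▷ (D' ⊗ D) := by
  have h : comp (tensSwap l₁ m₁) (tensSwap l₂ m₂) =
      ((P₂ ⊗ P₂') ⊗ P₁ ⊗ P₁') ◁ (β_ A' A).hom ≫ comp (tens l₁ m₁) (tens l₂ m₂) ≫
        ((Q₁ ⊗ Q₁') ⊗ Q₂ ⊗ Q₂') ◁ (β_ D D').hom := by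
    rw [tensSwap, tensSwap, wire_comp, comp_wire, ← MonoidalCategory.whiskerLeft_comp_assoc,
      SymmetricCategory.symmetry, MonoidalCategory.whiskerLeft_id, Category.id_comp, comp_wire']
  rw [h, tensSwap, ← whisker_exchange_assoc, reassoc_of% tens_compCell l₁ l₂ m₁ m₂,
    Category.assoc, Category.assoc, whisker_exchange]

lemma wire_yang_baxter (X Y Z : C) :
    (α_ X Y Z).hom ≫ (β_ X (Y ⊗ Z)).hom ≫ (β_ Y Z).hom ▷ X =
      (β_ (X ⊗ Y) Z).hom ≫ Z ◁ (β_ X Y).hom ≫ (α_ Z Y X).inv := by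
  have h := BraidedCategory.yang_baxter X Y Z
  rw [← cancel_epi (α_ X Y Z).hom, ← cancel_mono (α_ Z Y X).inv] at h
  simpa [BraidedCategory.braiding_tensor_left_hom, BraidedCategory.braiding_tensor_right_hom]
    using h

lemma tens_wires {P A₁ A Q B₁ B P' A₁' A' Q' B₁' B' : C} (f : A₁ ⟶ A) (l : P ⊗ A ⟶ Q ⊗ B)
    (g : B ⟶ B₁) (f' : A₁' ⟶ A') (m : P' ⊗ A' ⟶ Q' ⊗ B') (g' : B' ⟶ B₁') :
    tens (P ◁ f ≫ l ≫ Q ◁ g) (P' ◁ f' ≫ m ≫ Q' ◁ g') =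
      (P ⊗ P') ◁ (f ⊗ₘ f') ≫ tens l m ≫ (Q ⊗ Q') ◁ (g ⊗ₘ g') := by
  simp only [tens_comp, tens_wire]

lemma tensSwap_assoc {P A Q B P' A' Q' B' P'' A'' Q'' B'' : C} (l : P ⊗ A ⟶ Q ⊗ B)
    (m : P' ⊗ A' ⟶ Q' ⊗ B') (n : P'' ⊗ A'' ⟶ Q'' ⊗ B'') :
    tensSwap (tensSwap l m) n ≫ ((α_ Q Q' Q'').hom ⊗ₘ (α_ B'' B' B).inv) =
      ((α_ P P' P'').hom ⊗ₘ (α_ A'' A' A).inv) ≫ tensSwap l (tensSwap m n) := by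
  have h := tens_assoc l m n
  have h1 := tens_wires (β_ A' A).hom (tens l m) (β_ B B').hom (𝟙 A'') n (𝟙 B'')
  have h2 := tens_wires (𝟙 A) l (𝟙 B) (β_ A'' A').hom (tens m n) (β_ B' B'').hom
  simp only [MonoidalCategory.whiskerLeft_id, Category.id_comp, Category.comp_id, tensorHom_id,
    id_tensorHom] at h1 h2
  have y1 : (β_ A'' (A' ⊗ A)).hom ≫ (β_ A' A).hom ▷ A'' ≫ (α_ A A' A'').hom =
      (α_ A'' A' A).inv ≫ (β_ (A'' ⊗ A') A).hom ≫ A ◁ (β_ A'' A').hom := by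
    rw [← cancel_epi (α_ A'' A' A).hom, ← cancel_mono (α_ A A' A'').inv]
    simpa only [Category.assoc, Iso.hom_inv_id, Category.comp_id, Iso.hom_inv_id_assoc]
      using wire_yang_baxter A'' A' A
  have y2 : (β_ B B').hom ▷ B'' ≫ (β_ (B' ⊗ B) B'').hom ≫ (α_ B'' B' B).inv =
      (α_ B B' B'').hom ≫ B ◁ (β_ B' B'').hom ≫ (β_ B (B'' ⊗ B')).hom := by
    rw [BraidedCategory.braiding_naturality_left_assoc, BraidedCategory.braiding_naturality_right,
      wire_yang_baxter]
  simp only [tensSwap, h1, h2, Category.assoc, whiskerLeft_comp_tensorHom,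
    tensorHom_comp_whiskerLeft_assoc, y1, y2]
  rw [← tensorHom_comp_whiskerLeft, reassoc_of% h, ← y1,
    whiskerLeft_comp_tensorHom_assoc, whiskerLeft_comp_tensorHom_assoc]
  simp only [MonoidalCategory.whiskerLeft_comp]

lemma tensSwap_leftUnitor {P A Q B : C} (l : P ⊗ A ⟶ Q ⊗ B) :
    tensSwap (𝟙 (𝟙_ C ⊗ 𝟙_ C)) l ≫ ((λ_ Q).hom ⊗ₘ (ρ_ B).hom) =
      ((λ_ P).hom ⊗ₘ (ρ_ A).hom) ≫ l := by
  have h := tens_leftUnitor l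
  simp only [tensSwap, Category.assoc, whiskerLeft_comp_tensorHom, braiding_rightUnitor, h]
  rw [whiskerLeft_comp_tensorHom_assoc, braiding_leftUnitor]

lemma tensSwap_rightUnitor {P A Q B : C} (l : P ⊗ A ⟶ Q ⊗ B) :
    tensSwap l (𝟙 (𝟙_ C ⊗ 𝟙_ C)) ≫ ((ρ_ Q).hom ⊗ₘ (λ_ B).hom) =
      ((ρ_ P).hom ⊗ₘ (λ_ A).hom) ≫ l := by
  have h := tens_rightUnitor l
  simp only [tensSwap, Category.assoc, whiskerLeft_comp_tensorHom, braiding_leftUnitor, h]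
  rw [whiskerLeft_comp_tensorHom_assoc, braiding_rightUnitor]

lemma tensSwap_braiding {P A Q B P' A' Q' B' : C} (l : P ⊗ A ⟶ Q ⊗ B) (m : P' ⊗ A' ⟶ Q' ⊗ B') :
    tensSwap l m ≫ ((β_ Q Q').hom ⊗ₘ (β_ B' B).hom) =
      ((β_ P P').hom ⊗ₘ (β_ A' A).hom) ≫ tensSwap m l := by
  have h := tens_braiding l m
  simp only [tensSwap, Category.assoc, tensorHom_comp_whiskerLeft_assoc,
    whiskerLeft_comp_tensorHom]
  rw [← tensorHom_comp_whiskerLeft, reassoc_of% h, whiskerLeft_comp_tensorHom_assoc]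

lemma naturality_switch {P A Q B P' A' Q' B' : C} {T : P ⊗ A ⟶ Q ⊗ B} {T' : P' ⊗ A' ⟶ Q' ⊗ B'}
    {p : P ⟶ P'} {q : Q ⟶ Q'} (a : A' ≅ A) (b : B' ≅ B)
    (h : T ≫ (q ⊗ₘ b.inv) = (p ⊗ₘ a.inv) ≫ T') :
    (P ◁ a.hom ≫ T) ≫ q ▷ B = p ▷ A' ≫ T' ≫ Q' ◁ b.hom := by
  rw [← cancel_mono (Q' ◁ b.inv), ← cancel_epi (P ◁ a.inv)]
  rw [MonoidalCategory.tensorHom_def, MonoidalCategory.tensorHom_def'] at h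
  simp only [Category.assoc, ← MonoidalCategory.whiskerLeft_comp_assoc, Iso.inv_hom_id,
    MonoidalCategory.whiskerLeft_id, Category.id_comp, h, Iso.hom_inv_id,
    ← MonoidalCategory.whiskerLeft_comp, Category.comp_id]

end Cell

/-- The objects `(A, A')` of the category of learners of `C`: pairs of objects of `C`. -/
structure Learn (C : Type u) where
  fst : C
  snd : C

namespace Learn

variable {C : Type u} [Category.{v} C] [MonoidalCategory C] [SymmetricCategory C]

/-- A representative `(l | r) : (A, A') ⟶ (B, B')` of a learner: residuals `P` and `Q` with
`l : P ⊗ A ⟶ Q ⊗ B` and `r : Q ⊗ B' ⟶ P ⊗ A'`. -/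
structure Rep (X Y : Learn C) where
  P : C
  Q : C
  l : P ⊗ X.fst ⟶ Q ⊗ Y.fst
  r : Q ⊗ Y.snd ⟶ P ⊗ X.snd

/-- The relation generating the coend over `(P, Q)` of
`C(P ⊗ A, Q ⊗ B) × C(Q ⊗ B', P ⊗ A')`: morphisms `p` and `q` between residuals may be moved
from one component to the other. -/
inductive CoendRel (X Y : Learn C) : Rep X Y → Rep X Y → Prop
  | intro {P P' Q Q' : C} (p : P ⟶ P') (q : Q ⟶ Q')
      (l : P' ⊗ X.fst ⟶ Q ⊗ Y.fst) (r : Q' ⊗ Y.snd ⟶ P ⊗ X.snd) :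
      CoendRel X Y ⟨P, Q, p ▷ X.fst ≫ l, q ▷ Y.snd ≫ r⟩ ⟨P', Q', l ≫ q ▷ Y.fst, r ≫ p ▷ X.snd⟩

/-- Learners: elements of the coend, that is, representatives up to the equivalence relation
generated by `CoendRel`. -/
instance : Quiver.{max u v} (Learn C) where
  Hom X Y := Quot (CoendRel X Y)

/-- The learner represented by `(l | r)`. -/
def hom {X Y : Learn C} {P Q : C} (l : P ⊗ X.fst ⟶ Q ⊗ Y.fst) (r : Q ⊗ Y.snd ⟶ P ⊗ X.snd) :
    X ⟶ Y :=
  Quot.mk _ ⟨P, Q, l, r⟩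

lemma hom_slide {X Y : Learn C} {P P' Q Q' : C} (p : P ⟶ P') (q : Q ⟶ Q')
    (l : P' ⊗ X.fst ⟶ Q ⊗ Y.fst) (r : Q' ⊗ Y.snd ⟶ P ⊗ X.snd) :
    hom (X := X) (Y := Y) (p ▷ X.fst ≫ l) (q ▷ Y.snd ≫ r) =
      hom (l ≫ q ▷ Y.fst) (r ≫ p ▷ X.snd) :=
  Quot.sound (.intro p q l r)

lemma hom_eq_hom {X Y : Learn C} {P P' Q Q' : C} (p : P ≅ P') (q : Q ≅ Q')
    {l : P ⊗ X.fst ⟶ Q ⊗ Y.fst} {r : Q ⊗ Y.snd ⟶ P ⊗ X.snd}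
    {l' : P' ⊗ X.fst ⟶ Q' ⊗ Y.fst} {r' : Q' ⊗ Y.snd ⟶ P' ⊗ X.snd}
    (hl : l ≫ q.hom ▷ Y.fst = p.hom ▷ X.fst ≫ l')
    (hr : r ≫ p.hom ▷ X.snd = q.hom ▷ Y.snd ≫ r') :
    hom (X := X) (Y := Y) l r = hom l' r' := by
  have h1 : l = p.hom ▷ X.fst ≫ l' ≫ q.inv ▷ Y.fst := by
    rw [← reassoc_of% hl]; simp
  have h2 : r = q.hom ▷ Y.snd ≫ r' ≫ p.inv ▷ X.snd := by
    rw [← reassoc_of% hr]; simp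
  rw [h1, h2, hom_slide]
  simp

lemma hom_ind {X Y : Learn C} {motive : (X ⟶ Y) → Prop}
    (h : ∀ (P Q : C) (l : P ⊗ X.fst ⟶ Q ⊗ Y.fst) (r : Q ⊗ Y.snd ⟶ P ⊗ X.snd), motive (hom l r))
    (f : X ⟶ Y) : motive f :=
  Quot.ind (fun x => h x.P x.Q x.l x.r) f

/-- The identity has residuals `I`, `I` and components `𝟙`; the composite of `(l₁ | r₁)` and
`(l₂ | r₂)` has residuals `P₂ ⊗ P₁` and `Q₁ ⊗ Q₂`. -/
instance : CategoryStruct.{max u v} (Learn C) where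
  id X := hom (𝟙 (𝟙_ C ⊗ X.fst)) (𝟙 (𝟙_ C ⊗ X.snd))
  comp := Quot.map₂ (fun a b => ⟨b.P ⊗ a.P, a.Q ⊗ b.Q, Cell.comp a.l b.l, Cell.comp b.r a.r⟩)
    (by
      rintro ⟨P₁, Q₁, l₁, r₁⟩ _ _ ⟨p, q, l, r⟩
      dsimp only
      rw [Cell.comp_slide_left', Cell.comp_slide_left, Cell.comp_slide_right,
        Cell.comp_slide_right']
      exact .intro (p ▷ P₁) (Q₁ ◁ q) (Cell.comp l₁ l) (Cell.comp r r₁))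
    (by
      rintro _ _ ⟨P₂, Q₂, l₂, r₂⟩ ⟨p, q, l, r⟩
      dsimp only
      rw [Cell.comp_slide_left', Cell.comp_slide_left, Cell.comp_slide_right,
        Cell.comp_slide_right']
      exact .intro (P₂ ◁ p) (q ▷ Q₂) (Cell.comp l l₂) (Cell.comp r₂ r))

lemma id_def (X : Learn C) : 𝟙 X = hom (𝟙 (𝟙_ C ⊗ X.fst)) (𝟙 (𝟙_ C ⊗ X.snd)) := rfl

lemma hom_comp_hom {X Y Z : Learn C} {P₁ Q₁ P₂ Q₂ : C}
    (l₁ : P₁ ⊗ X.fst ⟶ Q₁ ⊗ Y.fst) (r₁ : Q₁ ⊗ Y.snd ⟶ P₁ ⊗ X.snd)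
    (l₂ : P₂ ⊗ Y.fst ⟶ Q₂ ⊗ Z.fst) (r₂ : Q₂ ⊗ Z.snd ⟶ P₂ ⊗ Y.snd) :
    hom l₁ r₁ ≫ hom l₂ r₂ = hom (Cell.comp l₁ l₂) (Cell.comp r₂ r₁) := rfl

instance : Category.{max u v} (Learn C) where
  id_comp f := by
    induction f using hom_ind with | h P Q l r => ?_
    exact hom_eq_hom (ρ_ P) (λ_ Q) (by simp [Cell.id_comp']) (by simp [Cell.comp_id'])
  comp_id f := by
    induction f using hom_ind with | h P Q l r => ?_
    exact hom_eq_hom (λ_ P) (ρ_ Q) (by simp [Cell.comp_id']) (by simp [Cell.id_comp'])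
  assoc f g h := by
    induction f using hom_ind with | h P₁ Q₁ l₁ r₁ => ?_
    induction g using hom_ind with | h P₂ Q₂ l₂ r₂ => ?_
    induction h using hom_ind with | h P₃ Q₃ l₃ r₃ => ?_
    refine hom_eq_hom (α_ _ _ _).symm (α_ _ _ _) (Cell.comp_assoc l₁ l₂ l₃) ?_
    have := Cell.comp_assoc r₃ r₂ r₁
    rw [← cancel_mono ((α_ _ _ _).hom ▷ _)]
    rw [Iso.symm_hom, Category.assoc, ← comp_whiskerRight, Iso.inv_hom_id, Category.assoc, this,
      ← comp_whiskerRight_assoc]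
    simp

/-- The image `(I ⊗ f | I ⊗ g)` of a morphism `(f, g)` of `C × Cᵒᵖ`. -/
def ofPair {X Y : Learn C} (f : X.fst ⟶ Y.fst) (g : Y.snd ⟶ X.snd) : X ⟶ Y :=
  hom (𝟙_ C ◁ f) (𝟙_ C ◁ g)

lemma hom_comp_ofPair {X Y Z : Learn C} {P Q : C} (l : P ⊗ X.fst ⟶ Q ⊗ Y.fst)
    (r : Q ⊗ Y.snd ⟶ P ⊗ X.snd) (f : Y.fst ⟶ Z.fst) (g : Z.snd ⟶ Y.snd) :
    hom l r ≫ ofPair f g = hom (l ≫ Q ◁ f) (Q ◁ g ≫ r) := by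
  refine hom_eq_hom (λ_ _) (ρ_ _) ?_ ?_
  · have := Cell.comp_wire' l (𝟙 (𝟙_ C ⊗ Y.fst)) f
    rw [Category.id_comp] at this
    rw [this]
    simp [Cell.comp_id']
  · have := Cell.wire_comp g (𝟙 (𝟙_ C ⊗ Y.snd)) r
    rw [Category.comp_id] at this
    rw [this]
    simp [Cell.id_comp', whisker_exchange_assoc]

lemma ofPair_comp_hom {X Y Z : Learn C} {P Q : C} (f : X.fst ⟶ Y.fst) (g : Y.snd ⟶ X.snd)
    (l : P ⊗ Y.fst ⟶ Q ⊗ Z.fst) (r : Q ⊗ Z.snd ⟶ P ⊗ Y.snd) :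
    ofPair f g ≫ hom l r = hom (P ◁ f ≫ l) (r ≫ P ◁ g) := by
  refine hom_eq_hom (ρ_ _) (λ_ _) ?_ ?_
  · have := Cell.wire_comp f (𝟙 (𝟙_ C ⊗ Y.fst)) l
    rw [Category.comp_id] at this
    rw [this]
    simp [Cell.id_comp', whisker_exchange_assoc]
  · have := Cell.comp_wire' r (𝟙 (𝟙_ C ⊗ Y.snd)) g
    rw [Category.id_comp] at this
    rw [this]
    simp [Cell.comp_id']

@[simp]
lemma ofPair_id (X : Learn C) : ofPair (𝟙 X.fst) (𝟙 X.snd) = 𝟙 X := by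
  simp [ofPair, id_def]

@[simp]
lemma ofPair_comp {X Y Z : Learn C} (f : X.fst ⟶ Y.fst) (g : Y.snd ⟶ X.snd)
    (f' : Y.fst ⟶ Z.fst) (g' : Z.snd ⟶ Y.snd) :
    (ofPair f g : X ⟶ Y) ≫ ofPair f' g' = ofPair (f ≫ f') (g' ≫ g) := by
  rw [ofPair, hom_comp_ofPair]; simp [ofPair]

/-- The image of an isomorphism of `C × Cᵒᵖ`. -/
def isoOfPair {X Y : Learn C} (f : X.fst ≅ Y.fst) (g : Y.snd ≅ X.snd) : X ≅ Y where
  hom := ofPair f.hom g.hom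
  inv := ofPair f.inv g.inv

lemma isoOfPair_hom {X Y : Learn C} (f : X.fst ≅ Y.fst) (g : Y.snd ≅ X.snd) :
    (isoOfPair f g).hom = ofPair f.hom g.hom := rfl

/-- The tensor product of learners, with residuals `P ⊗ P'` and `Q ⊗ Q'`. -/
def tensor {X X' Y Y' : Learn C} : (X ⟶ Y) → (X' ⟶ Y') →
    ((⟨X.fst ⊗ X'.fst, X'.snd ⊗ X.snd⟩ : Learn C) ⟶ ⟨Y.fst ⊗ Y'.fst, Y'.snd ⊗ Y.snd⟩) :=
  Quot.map₂ (fun a b => ⟨a.P ⊗ b.P, a.Q ⊗ b.Q, Cell.tens a.l b.l, Cell.tensSwap a.r b.r⟩)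
    (by
      rintro ⟨P₁, Q₁, l₁, r₁⟩ _ _ ⟨p, q, l, r⟩
      have h1 := Cell.tens_slide (𝟙 P₁) l₁ (𝟙 Q₁) p l (𝟙 _)
      have h2 := Cell.tensSwap_slide (𝟙 Q₁) r₁ (𝟙 P₁) q r (𝟙 _)
      have h3 := Cell.tens_slide (𝟙 P₁) l₁ (𝟙 Q₁) (𝟙 _) l q
      have h4 := Cell.tensSwap_slide (𝟙 Q₁) r₁ (𝟙 P₁) (𝟙 _) r p
      simp only [id_whiskerRight, Category.id_comp, Category.comp_id, id_tensorHom,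
        MonoidalCategory.whiskerLeft_id] at h1 h2 h3 h4
      dsimp only
      rw [h1, h2, h3, h4]
      exact .intro (X := ⟨_, _⟩) (Y := ⟨_, _⟩) (P₁ ◁ p) (Q₁ ◁ q) (Cell.tens l₁ l) (Cell.tensSwap r₁ r))
    (by
      rintro _ _ ⟨P₁, Q₁, l₁, r₁⟩ ⟨p, q, l, r⟩
      have h1 := Cell.tens_slide p l (𝟙 _) (𝟙 P₁) l₁ (𝟙 Q₁)
      have h2 := Cell.tensSwap_slide q r (𝟙 _) (𝟙 Q₁) r₁ (𝟙 P₁)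
      have h3 := Cell.tens_slide (𝟙 _) l q (𝟙 P₁) l₁ (𝟙 Q₁)
      have h4 := Cell.tensSwap_slide (𝟙 _) r p (𝟙 Q₁) r₁ (𝟙 P₁)
      simp only [id_whiskerRight, Category.id_comp, Category.comp_id, tensorHom_id] at h1 h2 h3 h4
      dsimp only
      rw [h1, h2, h3, h4]
      exact .intro (X := ⟨_, _⟩) (Y := ⟨_, _⟩) (p ▷ P₁) (q ▷ Q₁) (Cell.tens l l₁) (Cell.tensSwap r r₁))

/-- `(A, A') ⊗ (B, B') = (A ⊗ B, B' ⊗ A')`, with structure morphisms the images of those of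
`C × Cᵒᵖ`. -/
instance : MonoidalCategoryStruct (Learn C) where
  tensorObj X Y := ⟨X.fst ⊗ Y.fst, Y.snd ⊗ X.snd⟩
  tensorHom f g := tensor f g
  whiskerLeft X _ _ f := tensor (𝟙 X) f
  whiskerRight f Y := tensor f (𝟙 Y)
  tensorUnit := ⟨𝟙_ C, 𝟙_ C⟩
  associator X Y Z := isoOfPair (α_ X.fst Y.fst Z.fst) (α_ Z.snd Y.snd X.snd)
  leftUnitor X := isoOfPair (λ_ X.fst) (ρ_ X.snd).symm
  rightUnitor X := isoOfPair (ρ_ X.fst) (λ_ X.snd).symm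

lemma hom_tensor_hom {X X' Y Y' : Learn C} {P Q P' Q' : C}
    (l : P ⊗ X.fst ⟶ Q ⊗ Y.fst) (r : Q ⊗ Y.snd ⟶ P ⊗ X.snd)
    (l' : P' ⊗ X'.fst ⟶ Q' ⊗ Y'.fst) (r' : Q' ⊗ Y'.snd ⟶ P' ⊗ X'.snd) :
    (hom l r : X ⟶ Y) ⊗ₘ (hom l' r' : X' ⟶ Y') =
      (hom (Cell.tens l l') (Cell.tensSwap r r') : (X ⊗ X' : Learn C) ⟶ (Y ⊗ Y' : Learn C)) := rfl

@[simp]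
lemma ofPair_tensor_ofPair {X X' Y Y' : Learn C} (f : X.fst ⟶ Y.fst) (g : Y.snd ⟶ X.snd)
    (f' : X'.fst ⟶ Y'.fst) (g' : Y'.snd ⟶ X'.snd) :
    (ofPair f g : X ⟶ Y) ⊗ₘ (ofPair f' g' : X' ⟶ Y') =
      (ofPair (f ⊗ₘ f') (g' ⊗ₘ g) : (X ⊗ X' : Learn C) ⟶ (Y ⊗ Y' : Learn C)) := by
  refine hom_eq_hom (λ_ _) (λ_ _) ?_ ?_
  · rw [Cell.tens_wire]
    exact whisker_exchange _ _
  · rw [Cell.tensSwap_wire]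
    exact whisker_exchange _ _

lemma associator_def (X Y Z : Learn C) : (α_ X Y Z).hom =
  ofPair (α_ X.fst Y.fst Z.fst).hom (α_ Z.snd Y.snd X.snd).hom := rfl

lemma associator_inv_def (X Y Z : Learn C) : (α_ X Y Z).inv =
  ofPair (α_ X.fst Y.fst Z.fst).inv (α_ Z.snd Y.snd X.snd).inv := rfl

lemma leftUnitor_def (X : Learn C) : (λ_ X).hom = ofPair (λ_ X.fst).hom (ρ_ X.snd).inv := rfl

lemma rightUnitor_def (X : Learn C) : (ρ_ X).hom = ofPair (ρ_ X.fst).hom (λ_ X.snd).inv := rfl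

instance : MonoidalCategory (Learn C) := .ofTensorHom
  (id_tensorHom_id := fun X Y => by
    rw [← ofPair_id, ← ofPair_id, ofPair_tensor_ofPair, id_tensorHom_id, id_tensorHom_id]
    exact ofPair_id _)
  (tensorHom_comp_tensorHom := fun f₁ f₂ g₁ g₂ => by
    induction f₁ using hom_ind with | h P₁ Q₁ l₁ r₁ => ?_
    induction f₂ using hom_ind with | h P₂ Q₂ l₂ r₂ => ?_
    induction g₁ using hom_ind with | h P₃ Q₃ l₃ r₃ => ?_
    induction g₂ using hom_ind with | h P₄ Q₄ l₄ r₄ => ?_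
    simp only [hom_tensor_hom, hom_comp_hom]
    exact hom_eq_hom (asIso (tensorμ P₃ P₄ P₁ P₂)) (asIso (tensorμ Q₁ Q₂ Q₃ Q₄))
      (Cell.tens_compCell _ _ _ _).symm (Cell.tensSwap_compCell _ _ _ _).symm)
  (associator_naturality := fun {X₁ X₂ X₃ Y₁ Y₂ Y₃} f₁ f₂ f₃ => by
    induction f₁ using hom_ind with | h P₁ Q₁ l₁ r₁ => ?_
    induction f₂ using hom_ind with | h P₂ Q₂ l₂ r₂ => ?_
    induction f₃ using hom_ind with | h P₃ Q₃ l₃ r₃ => ?_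
    rw [associator_def, associator_def, hom_tensor_hom, hom_tensor_hom, hom_tensor_hom,
      hom_tensor_hom]
    refine (hom_comp_ofPair _ _ _ _).trans (.trans ?_ (ofPair_comp_hom _ _ _ _).symm)
    refine hom_eq_hom (α_ _ _ _) (α_ _ _ _) ?_ ?_
    · have h := Cell.tens_assoc l₁ l₂ l₃
      rw [MonoidalCategory.tensorHom_def', MonoidalCategory.tensorHom_def, Category.assoc] at h
      rw [Category.assoc]
      exact h
    · exact Cell.naturality_switch (α_ _ _ _) (α_ _ _ _) (Cell.tensSwap_assoc r₁ r₂ r₃))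
  (leftUnitor_naturality := fun {X Y} f => by
    induction f using hom_ind with | h P Q l r => ?_
    rw [leftUnitor_def, leftUnitor_def, id_def, hom_tensor_hom]
    refine (hom_comp_ofPair _ _ _ _).trans (.trans ?_ (ofPair_comp_hom _ _ _ _).symm)
    refine hom_eq_hom (λ_ _) (λ_ _) ?_ ?_
    · have h := Cell.tens_leftUnitor l
      rw [MonoidalCategory.tensorHom_def', MonoidalCategory.tensorHom_def, Category.assoc] at h
      rw [Category.assoc]
      exact h
    · exact Cell.naturality_switch (ρ_ _).symm (ρ_ _).symm (Cell.tensSwap_leftUnitor r))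
  (rightUnitor_naturality := fun {X Y} f => by
    induction f using hom_ind with | h P Q l r => ?_
    rw [rightUnitor_def, rightUnitor_def, id_def, hom_tensor_hom]
    refine (hom_comp_ofPair _ _ _ _).trans (.trans ?_ (ofPair_comp_hom _ _ _ _).symm)
    refine hom_eq_hom (ρ_ _) (ρ_ _) ?_ ?_
    · have h := Cell.tens_rightUnitor l
      rw [MonoidalCategory.tensorHom_def', MonoidalCategory.tensorHom_def, Category.assoc] at h
      rw [Category.assoc]
      exact h
    · exact Cell.naturality_switch (λ_ _).symm (λ_ _).symm (Cell.tensSwap_rightUnitor r))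
  (pentagon := fun W X Y Z => by
    simp only [associator_def, ← ofPair_id, ofPair_tensor_ofPair]
    rw [ofPair_comp, ofPair_comp, ofPair_comp]
    exact congrArg₂ ofPair (by simp; exact pentagon _ _ _ _) (by simp; exact pentagon _ _ _ _))
  (triangle := fun X Y => by
    simp only [associator_def, leftUnitor_def, rightUnitor_def, ← ofPair_id, ofPair_tensor_ofPair]
    rw [ofPair_comp]
    exact congrArg₂ ofPair (by simp; exact triangle _ _)
      (by simp; exact triangle_assoc_comp_right_inv (C := C) Y.snd X.snd))

lemma whiskerLeft_ofPair (X : Learn C) {Y Z : Learn C} (f : Y.fst ⟶ Z.fst) (g : Z.snd ⟶ Y.snd) :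
    X ◁ (ofPair f g : Y ⟶ Z) =
      (ofPair (X.fst ◁ f) (g ▷ X.snd) : (X ⊗ Y : Learn C) ⟶ (X ⊗ Z : Learn C)) := by
  rw [← id_tensorHom, ← ofPair_id, ofPair_tensor_ofPair, id_tensorHom, tensorHom_id]

lemma ofPair_whiskerRight {Y Z : Learn C} (f : Y.fst ⟶ Z.fst) (g : Z.snd ⟶ Y.snd) (X : Learn C) :
    (ofPair f g : Y ⟶ Z) ▷ X =
      (ofPair (f ▷ X.fst) (X.snd ◁ g) : (Y ⊗ X : Learn C) ⟶ (Z ⊗ X : Learn C)) := by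
  rw [← tensorHom_id, ← ofPair_id, ofPair_tensor_ofPair, id_tensorHom, tensorHom_id]

/-- The symmetry of learners, the image of that of `C × Cᵒᵖ`. -/
def braidIso (X Y : Learn C) : X ⊗ Y ≅ Y ⊗ X := isoOfPair (β_ X.fst Y.fst) (β_ X.snd Y.snd)

lemma braidIso_hom (X Y : Learn C) : (braidIso X Y).hom =
  ofPair (β_ X.fst Y.fst).hom (β_ X.snd Y.snd).hom := rfl

lemma braidIso_naturality {X X' Y Y' : Learn C} (f : X ⟶ Y) (g : X' ⟶ Y') :
    (f ⊗ₘ g) ≫ (braidIso Y Y').hom = (braidIso X X').hom ≫ (g ⊗ₘ f) := by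
  induction f using hom_ind with | h P Q l r => ?_
  induction g using hom_ind with | h P' Q' l' r' => ?_
  rw [hom_tensor_hom, hom_tensor_hom]
  refine (hom_comp_ofPair _ _ _ _).trans (.trans ?_ (ofPair_comp_hom _ _ _ _).symm)
  refine hom_eq_hom (β_ _ _) (β_ _ _) ?_ ?_
  · have h := Cell.tens_braiding l l'
    rw [MonoidalCategory.tensorHom_def', MonoidalCategory.tensorHom_def, Category.assoc] at h
    rw [Category.assoc]
    exact h
  · exact Cell.naturality_switch (β_ _ _) (β_ _ _) (by
      simpa [SymmetricCategory.braiding_swap_eq_inv_braiding] using Cell.tensSwap_braiding r r')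

instance : SymmetricCategory (Learn C) where
  braiding := braidIso
  braiding_naturality_right X _ _ f := by
    rw [← id_tensorHom, braidIso_naturality, tensorHom_id]
  braiding_naturality_left f Z := by
    rw [← tensorHom_id, braidIso_naturality, id_tensorHom]
  hexagon_forward X Y Z := by
    rw [← id_tensorHom, ← tensorHom_id]
    simp only [associator_def, braidIso_hom, ← ofPair_id, ofPair_tensor_ofPair]
    rw [ofPair_comp, ofPair_comp, ofPair_comp, ofPair_comp]
    exact congrArg₂ ofPair (by simp; exact BraidedCategory.hexagon_forward _ _ _)
      (by simp; exact BraidedCategory.hexagon_forward _ _ _)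
  hexagon_reverse X Y Z := by
    rw [← id_tensorHom, ← tensorHom_id]
    simp only [associator_inv_def, braidIso_hom, ← ofPair_id, ofPair_tensor_ofPair]
    rw [ofPair_comp, ofPair_comp, ofPair_comp, ofPair_comp]
    exact congrArg₂ ofPair (by simp; exact BraidedCategory.hexagon_reverse _ _ _)
      (by simp; exact BraidedCategory.hexagon_reverse _ _ _)
  symmetry X Y := by
    rw [braidIso_hom, braidIso_hom, ofPair_comp]
    exact (congrArg₂ ofPair (by simp; rfl) (by simp; rfl)).trans (ofPair_id _)

end Learn

namespace Learn

variable {C : Type u} [Category.{v} C] [MonoidalCategory C] [SymmetricCategory C]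

variable (C) in
/-- The functor `C ⥤ Learn C` sending `f : A ⟶ B` to `(I ⊗ f | 𝟙) : (A, I) ⟶ (B, I)`. -/
abbrev incl : C ⥤ Learn C where
  obj A := ⟨A, 𝟙_ C⟩
  map {A B} f := hom (X := ⟨A, 𝟙_ C⟩) (Y := ⟨B, 𝟙_ C⟩) (𝟙_ C ◁ f) (𝟙 (𝟙_ C ⊗ 𝟙_ C))
  map_id A := by rw [MonoidalCategory.whiskerLeft_id]; rfl
  map_comp {X Y Z} f g := by
    have h := ofPair_comp (X := ⟨X, 𝟙_ C⟩) (Y := ⟨Y, 𝟙_ C⟩) (Z := ⟨Z, 𝟙_ C⟩) f (𝟙 _) g (𝟙 _)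
    simp only [ofPair, MonoidalCategory.whiskerLeft_id, Category.comp_id] at h
    exact h.symm

lemma incl_map {A B : C} (f : A ⟶ B) :
    (incl C).map f = ofPair (X := (incl C).obj A) (Y := (incl C).obj B) f (𝟙 (𝟙_ C)) := by
  simp only [ofPair, MonoidalCategory.whiskerLeft_id]

variable (C) in
/-- The monoidal structure of `incl C`: the unit comparison is the identity of `(I, I)`, and
`(A, I) ⊗ (B, I) = (A ⊗ B, I ⊗ I) ⟶ (A ⊗ B, I)` is the image of the unitor of `I`. -/
def inclCoreMonoidal : (incl C).CoreMonoidal where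
  εIso := Iso.refl _
  μIso A B := isoOfPair (X := (incl C).obj A ⊗ (incl C).obj B) (Y := (incl C).obj (A ⊗ B))
    (Iso.refl (A ⊗ B)) (λ_ (𝟙_ C)).symm
  μIso_hom_natural_left {A B} f A' := by
    rw [incl_map, incl_map, ofPair_whiskerRight]
    refine (ofPair_comp _ _ _ _).trans (.trans ?_ (ofPair_comp _ _ _ _).symm)
    refine congrArg₂ ofPair ((Category.comp_id (f ▷ A')).trans (Category.id_comp (f ▷ A')).symm) ?_
    change (λ_ (𝟙_ C)).inv ≫ _ ◁ 𝟙 (𝟙_ C) = 𝟙 (𝟙_ C) ≫ (λ_ (𝟙_ C)).inv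
    simp
  μIso_hom_natural_right {A B} A' f := by
    rw [incl_map, incl_map, whiskerLeft_ofPair]
    refine (ofPair_comp _ _ _ _).trans (.trans ?_ (ofPair_comp _ _ _ _).symm)
    refine congrArg₂ ofPair ((Category.comp_id (A' ◁ f)).trans (Category.id_comp (A' ◁ f)).symm) ?_
    change (λ_ (𝟙_ C)).inv ≫ 𝟙 (𝟙_ C) ▷ _ = 𝟙 (𝟙_ C) ≫ (λ_ (𝟙_ C)).inv
    simp
  associativity X Y Z := by
    rw [incl_map, isoOfPair_hom, isoOfPair_hom, isoOfPair_hom, isoOfPair_hom,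
      ofPair_whiskerRight, whiskerLeft_ofPair, associator_def,
      ofPair_comp, ofPair_comp, ofPair_comp, ofPair_comp]
    refine congrArg₂ ofPair ?_ ?_
    · change 𝟙 (X ⊗ Y) ▷ Z ≫ 𝟙 ((X ⊗ Y) ⊗ Z) ≫ (α_ X Y Z).hom =
        (α_ X Y Z).hom ≫ X ◁ 𝟙 (Y ⊗ Z) ≫ 𝟙 (X ⊗ Y ⊗ Z)
      simp
    · change (𝟙 _ ≫ (λ_ (𝟙_ C)).inv) ≫ 𝟙_ C ◁ (λ_ (𝟙_ C)).inv =
        ((λ_ (𝟙_ C)).inv ≫ (λ_ (𝟙_ C)).inv ▷ 𝟙_ C) ≫ (α_ (𝟙_ C) (𝟙_ C) (𝟙_ C)).hom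
      simp [unitors_inv_equal]
  left_unitality X := by
    rw [incl_map, isoOfPair_hom, leftUnitor_def, Iso.refl_hom]
    change _ = 𝟙 _ ▷ _ ≫ _
    rw [id_whiskerRight, Category.id_comp, ofPair_comp]
    refine congrArg₂ ofPair (Category.id_comp (λ_ X).hom).symm ?_
    exact (unitors_inv_equal.symm).trans (Category.id_comp (λ_ (𝟙_ C)).inv).symm
  right_unitality X := by
    rw [incl_map, isoOfPair_hom, rightUnitor_def, Iso.refl_hom]
    change _ = _ ◁ 𝟙 _ ≫ _
    rw [MonoidalCategory.whiskerLeft_id, Category.id_comp, ofPair_comp]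
    refine congrArg₂ ofPair (Category.id_comp (ρ_ X).hom).symm ?_
    exact (Category.id_comp (λ_ (𝟙_ C)).inv).symm

instance : (incl C).Braided where
  toMonoidal := (inclCoreMonoidal C).toMonoidal
  braided A B := by
    change (isoOfPair _ _).hom ≫ _ = (braidIso _ _).hom ≫ (isoOfPair _ _).hom
    rw [incl_map, isoOfPair_hom, isoOfPair_hom, braidIso_hom]
    refine (ofPair_comp _ _ _ _).trans (.trans ?_ (ofPair_comp _ _ _ _).symm)
    refine congrArg₂ ofPair
      ((Category.id_comp (β_ A B).hom).trans (Category.comp_id (β_ A B).hom).symm) ?_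
    change 𝟙 (𝟙_ C) ≫ (λ_ (𝟙_ C)).inv = (λ_ (𝟙_ C)).inv ≫ (β_ (𝟙_ C) (𝟙_ C)).hom
    simp [unitors_inv_equal]

/-- The dual `(A, A')* = (A', A)`. -/
def dual (X : Learn C) : Learn C := ⟨X.snd, X.fst⟩

/-- The cup `(I, I) ⟶ (A, A') ⊗ (A, A')* = (A ⊗ A', A ⊗ A')`, with residuals
`P = A ⊗ A'` and `Q = I`. -/
def cup (X : Learn C) : 𝟙_ (Learn C) ⟶ X ⊗ dual X :=
  hom (X := 𝟙_ (Learn C)) (Y := X ⊗ dual X) (P := X.fst ⊗ X.snd) (Q := 𝟙_ C)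
    ((ρ_ (X.fst ⊗ X.snd)).hom ≫ (λ_ (X.fst ⊗ X.snd)).inv)
    ((λ_ (X.fst ⊗ X.snd)).hom ≫ (ρ_ (X.fst ⊗ X.snd)).inv)

/-- The cap `(A, A')* ⊗ (A, A') = (A' ⊗ A, A' ⊗ A) ⟶ (I, I)`, with residuals
`P = I` and `Q = A' ⊗ A`. -/
def cap (X : Learn C) : dual X ⊗ X ⟶ 𝟙_ (Learn C) :=
  hom (X := dual X ⊗ X) (Y := 𝟙_ (Learn C)) (P := 𝟙_ C) (Q := X.snd ⊗ X.fst)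
    ((λ_ (X.snd ⊗ X.fst)).hom ≫ (ρ_ (X.snd ⊗ X.fst)).inv)
    ((ρ_ (X.snd ⊗ X.fst)).hom ≫ (λ_ (X.snd ⊗ X.fst)).inv)

/-- The snake `X ⟶ (X ⊗ X*) ⊗ X ⟶ X ⊗ (X* ⊗ X) ⟶ X`. -/
def snake (X : Learn C) : X ⟶ X :=
  (λ_ X).inv ≫ cup X ▷ X ≫ (α_ X (dual X) X).hom ≫ X ◁ cap X ≫ (ρ_ X).hom

/-- The smallest congruence of monoidal categories on `Learn C` identifying every snake
with the identity. -/
inductive AtempRel : HomRel (Learn C)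
  | snake (X : Learn C) : AtempRel (snake X) (𝟙 X)
  | refl {X Y : Learn C} (f : X ⟶ Y) : AtempRel f f
  | symm {X Y : Learn C} {f g : X ⟶ Y} : AtempRel f g → AtempRel g f
  | trans {X Y : Learn C} {f g h : X ⟶ Y} : AtempRel f g → AtempRel g h → AtempRel f h
  | comp {X Y Z : Learn C} {f f' : X ⟶ Y} {g g' : Y ⟶ Z} :
      AtempRel f f' → AtempRel g g' → AtempRel (f ≫ g) (f' ≫ g')
  | tensor {X Y X' Y' : Learn C} {f f' : X ⟶ Y} {g g' : X' ⟶ Y'} :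
      AtempRel f f' → AtempRel g g' → AtempRel (f ⊗ₘ g) (f' ⊗ₘ g')

instance : Congruence (AtempRel (C := C)) where
  comp_left f _ _ h := .comp (.refl f) h
  comp_right g h := .comp h (.refl g)
  equivalence := ⟨.refl, .symm, .trans⟩

end Learn

section

variable (C : Type u) [Category.{v} C] [MonoidalCategory C] [SymmetricCategory C]

/-- The category of atemporal learners: learners modulo the smallest monoidal congruence
identifying all snakes with identities. -/
abbrev Atemp : Type u := CategoryTheory.Quotient (Learn.AtempRel (C := C))

namespace Atemp

/-- The quotient functor. -/
abbrev quot : Learn C ⥤ Atemp C := CategoryTheory.Quotient.functor (Learn.AtempRel (C := C))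

variable {C}

/-- The tensor product of atemporal learners, induced by that of learners. -/
def tensor {X Y X' Y' : Atemp C} : (X ⟶ Y) → (X' ⟶ Y') →
    ((⟨X.as ⊗ X'.as⟩ : Atemp C) ⟶ ⟨Y.as ⊗ Y'.as⟩) :=
  Quot.map₂ (fun f g => f ⊗ₘ g)
    (fun f g g' h => by
      rw [HomRel.compClosure_iff_self] at h ⊢
      exact .tensor (.refl f) h)
    (fun f f' g h => by
      rw [HomRel.compClosure_iff_self] at h ⊢
      exact .tensor h (.refl g))

instance : MonoidalCategoryStruct (Atemp C) where
  tensorObj X Y := ⟨X.as ⊗ Y.as⟩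
  tensorHom f g := tensor f g
  whiskerLeft X _ _ f := tensor (𝟙 X) f
  whiskerRight f Y := tensor f (𝟙 Y)
  tensorUnit := ⟨𝟙_ (Learn C)⟩
  associator X Y Z := (quot C).mapIso (α_ X.as Y.as Z.as)
  leftUnitor X := (quot C).mapIso (λ_ X.as)
  rightUnitor X := (quot C).mapIso (ρ_ X.as)

lemma quot_tensor {X Y X' Y' : Learn C} (f : X ⟶ Y) (g : X' ⟶ Y') :
    (quot C).map f ⊗ₘ (quot C).map g = (quot C).map (f ⊗ₘ g) := rfl

lemma quot_comp {X Y Z : Learn C} (f : X ⟶ Y) (g : Y ⟶ Z) :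
    (quot C).map f ≫ (quot C).map g = (quot C).map (f ≫ g) := rfl

lemma ind {X Y : Atemp C} {motive : (X ⟶ Y) → Prop}
    (h : ∀ f : X.as ⟶ Y.as, motive ((quot C).map f)) (f : X ⟶ Y) : motive f :=
  Quot.ind h f

instance : MonoidalCategory (Atemp C) := .ofTensorHom
  (id_tensorHom_id := fun X Y => congrArg (quot C).map (id_tensorHom_id X.as Y.as))
  (tensorHom_comp_tensorHom := fun f₁ f₂ g₁ g₂ => by
    induction f₁ using ind with | h f₁ => ?_
    induction f₂ using ind with | h f₂ => ?_
    induction g₁ using ind with | h g₁ => ?_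
    induction g₂ using ind with | h g₂ => ?_
    exact congrArg (quot C).map (tensorHom_comp_tensorHom f₁ f₂ g₁ g₂))
  (associator_naturality := fun f₁ f₂ f₃ => by
    induction f₁ using ind with | h f₁ => ?_
    induction f₂ using ind with | h f₂ => ?_
    induction f₃ using ind with | h f₃ => ?_
    exact congrArg (quot C).map (associator_naturality f₁ f₂ f₃))
  (leftUnitor_naturality := fun f => by
    induction f using ind with | h f => ?_
    exact congrArg (quot C).map (leftUnitor_naturality f))
  (rightUnitor_naturality := fun f => by
    induction f using ind with | h f => ?_
    exact congrArg (quot C).map (rightUnitor_naturality f))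
  (pentagon := fun W X Y Z => congrArg (quot C).map (pentagon W.as X.as Y.as Z.as))
  (triangle := fun X Y => congrArg (quot C).map (triangle X.as Y.as))

instance : SymmetricCategory (Atemp C) where
  braiding X Y := (quot C).mapIso (β_ X.as Y.as)
  braiding_naturality_right X _ _ f := by
    induction f using ind with | h f => ?_
    exact congrArg (quot C).map (BraidedCategory.braiding_naturality_right X.as f)
  braiding_naturality_left f Z := by
    induction f using ind with | h f => ?_
    exact congrArg (quot C).map (BraidedCategory.braiding_naturality_left f Z.as)
  hexagon_forward X Y Z :=
    congrArg (quot C).map (BraidedCategory.hexagon_forward X.as Y.as Z.as)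
  hexagon_reverse X Y Z :=
    congrArg (quot C).map (BraidedCategory.hexagon_reverse X.as Y.as Z.as)
  symmetry X Y := congrArg (quot C).map (SymmetricCategory.symmetry X.as Y.as)

/-- The object `(A, A')`. -/
def obj (A A' : C) : Atemp C := ⟨⟨A, A'⟩⟩

/-- The class of the learner `(l | r) : (A, A') ⟶ (B, B')` with residuals `P` and `Q`. -/
def learner {A A' B B' P Q : C} (l : P ⊗ A ⟶ Q ⊗ B) (r : Q ⊗ B' ⟶ P ⊗ A') :
    obj A A' ⟶ obj B B' :=
  (quot C).map (Learn.hom (X := ⟨A, A'⟩) (Y := ⟨B, B'⟩) l r)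

variable (C)

/-- The quotient functor preserves the monoidal structure strictly. -/
def quotCoreMonoidal : (quot C).CoreMonoidal where
  εIso := Iso.refl _
  μIso X Y := Iso.refl _
  μIso_hom_natural_left f X := (Category.comp_id _).trans (Category.id_comp _).symm
  μIso_hom_natural_right X f := (Category.comp_id _).trans (Category.id_comp _).symm
  associativity X Y Z := by
    refine congrArg (quot C).map (a₁ := 𝟙 _ ▷ _ ≫ 𝟙 _ ≫ (α_ X Y Z).hom)
      (a₂ := (α_ X Y Z).hom ≫ _ ◁ 𝟙 _ ≫ 𝟙 _) ?_
    simp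
  left_unitality X := by
    refine congrArg (quot C).map (a₁ := (λ_ X).hom) (a₂ := 𝟙 _ ▷ _ ≫ 𝟙 _ ≫ (λ_ X).hom) ?_
    simp
  right_unitality X := by
    refine congrArg (quot C).map (a₁ := (ρ_ X).hom) (a₂ := _ ◁ 𝟙 _ ≫ 𝟙 _ ≫ (ρ_ X).hom) ?_
    simp

instance : (quot C).Braided where
  toMonoidal := (quotCoreMonoidal C).toMonoidal
  braided _ _ := (Category.id_comp _).trans (Category.comp_id _).symm

/-- The functor `C ⥤ Atemp C` sending `f : A ⟶ B` to the class of
`(I ⊗ f | 𝟙) : (A, I) ⟶ (B, I)`. -/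
def ι : C ⥤ Atemp C := Learn.incl C ⋙ quot C

instance : (ι C).Braided := inferInstanceAs (Learn.incl C ⋙ quot C).Braided

end Atemp

end

/-- The dual `(W ⊗ X ⟶ Y ⊗ Z)* : Z* ⊗ Y* ⟶ X* ⊗ W*` of a morphism between tensor products, with
`X* ⊗ W*` as the dual of `W ⊗ X`. -/
def mateTensor {D : Type u₂} [Category.{v₂} D] [MonoidalCategory D] [RightRigidCategory D]
    {W X Y Z : D} (f : W ⊗ X ⟶ Y ⊗ Z) : Zᘁ ⊗ Yᘁ ⟶ Xᘁ ⊗ Wᘁ :=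
  @rightAdjointMate D _ _ (W ⊗ X) (Y ⊗ Z) hasRightDualTensor hasRightDualTensor f

/-- The string diagram of `(l | r)` in a compact closed category `D`: create a pair `(FP)* ⊗ FP`
between `(FA')*` and `FA` with the cup of `FP`, apply `(F r)*` to `(FA')* ⊗ (FP)*` and `F l` to
`FP ⊗ FA`, and cancel `(FQ)* ⊗ FQ` with the cap of `FQ`. -/
def fhatMap {C : Type u₁} [Category.{v₁} C] [MonoidalCategory C]
    {D : Type u₂} [Category.{v₂} D] [MonoidalCategory D] [SymmetricCategory D]
    [RightRigidCategory D] (F : C ⥤ D) [F.Monoidal]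
    {A A' B B' P Q : C} (l : P ⊗ A ⟶ Q ⊗ B) (r : Q ⊗ B' ⟶ P ⊗ A') :
    (F.obj A')ᘁ ⊗ F.obj A ⟶ (F.obj B')ᘁ ⊗ F.obj B :=
  (F.obj A')ᘁ ◁ (λ_ (F.obj A)).inv ≫
  (F.obj A')ᘁ ◁ (η_ (F.obj P) (F.obj P)ᘁ ≫ (β_ (F.obj P) (F.obj P)ᘁ).hom) ▷ F.obj A ≫
  (F.obj A')ᘁ ◁ (α_ (F.obj P)ᘁ (F.obj P) (F.obj A)).hom ≫
  (α_ (F.obj A')ᘁ (F.obj P)ᘁ (F.obj P ⊗ F.obj A)).inv ≫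
  (mateTensor (Functor.LaxMonoidal.μ F Q B' ≫ F.map r ≫ Functor.OplaxMonoidal.δ F P A') ⊗ₘ
    (Functor.LaxMonoidal.μ F P A ≫ F.map l ≫ Functor.OplaxMonoidal.δ F Q B)) ≫
  (α_ (F.obj B')ᘁ (F.obj Q)ᘁ (F.obj Q ⊗ F.obj B)).hom ≫
  (F.obj B')ᘁ ◁ (α_ (F.obj Q)ᘁ (F.obj Q) (F.obj B)).inv ≫
  (F.obj B')ᘁ ◁ ε_ (F.obj Q) (F.obj Q)ᘁ ▷ F.obj B ≫
  (F.obj B')ᘁ ◁ (λ_ (F.obj B)).hom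

/-! Mates of morphisms with respect to arbitrary exact pairings. -/

/-! In a compact closed category the residuals of a learner can be closed up. Given `l : P ⊗ A ⟶ Q ⊗
B` and `s : A' ⊗ P' ⟶ B' ⊗ Q'`, where primes on residuals denote duals, create a pair `P' ⊗ P`
between `A'` and `A`, apply `s` and `l`, and cancel `Q' ⊗ Q`. This operation is `contract`, and
`fhatMap F l r` is the contraction of the conjugated image of `l` with the mate of that of `r`
(`fhatMap_eq`). The theorem then follows from properties of contraction.

Invariance under the coend relation: a morphism between residuals slides through a cup or a cap and
becomes its mate on the other side (`contract_slide`). Functoriality (`contract_comp`): the cups and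
caps of composite residuals are nested, and the cap of `Q₁` and the cup of `P₂` are entangled only
by symmetries, so they pull apart. Monoidality: the tensorator interchanges the middle wires and
applies structure isomorphisms; `contract_whiskerRight` gives naturality in one variable, and the
symmetry transfers it to the other.

Snakes: the cup and cap of `(A, A')` go to the coevaluation and evaluation of an exact pairing of
`(FA')* ⊗ FA` with `(FA)* ⊗ FA'` (`pairPairing`), so each snake goes to an identity by a snake
equation in the target. Strong monoidality extends this to the whole congruence
(`learnFunctor_map_eq`). Finally, `(A, I)` goes to `(FI)* ⊗ FA`, which is `FA` up to the dual of the
unit isomorphism of `F`.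

Mates are taken relative to arbitrary exact pairings because two duals of a tensor product compete:
`Y* ⊗ X*` and the chosen dual of `F(X ⊗ Y)`. The comparison between them is itself a mate (`dualμ`),
so its coherence follows from that of `F` by contravariance. -/

namespace CompactClosed

section Mate

variable {D : Type u} [Category.{v} D] [MonoidalCategory D]

/-- The mate `Y' ⟶ X'` of `f : X ⟶ Y`, where `X'` and `Y'` are right duals of `X` and `Y`. -/
def mate {X Y : D} (Y' X' : D) [ExactPairing X X'] [ExactPairing Y Y'] (f : X ⟶ Y) : Y' ⟶ X' :=
  @rightAdjointMate D _ _ X Y ⟨X'⟩ ⟨Y'⟩ f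

variable {X Y Z X' Y' Z' : D} [ExactPairing X X'] [ExactPairing Y Y'] [ExactPairing Z Z']

lemma mate_evaluation (f : X ⟶ Y) : mate Y' X' f ▷ X ≫ ε_ X X' = Y' ◁ f ≫ ε_ Y Y' :=
  @rightAdjointMate_comp_evaluation D _ _ X Y ⟨X'⟩ ⟨Y'⟩ f

lemma coevaluation_mate (f : X ⟶ Y) : η_ Y Y' ≫ Y ◁ mate Y' X' f = η_ X X' ≫ f ▷ X' :=
  @coevaluation_comp_rightAdjointMate D _ _ X Y ⟨X'⟩ ⟨Y'⟩ f

/-- Bending the wire `X` by the adjunction between tensoring with `X` and with `X'` recovers a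
morphism from its pairing with the evaluation. -/
lemma evaluation_injective {W : D} {f g : W ⟶ X'} (h : f ▷ X ≫ ε_ X X' = g ▷ X ≫ ε_ X X') :
    f = g := by
  have hf := @tensorRightHomEquiv_whiskerRight_comp_evaluation D _ _ X W ⟨X'⟩ f
  have hg := @tensorRightHomEquiv_whiskerRight_comp_evaluation D _ _ X W ⟨X'⟩ g
  rw [← cancel_mono (λ_ X').inv]
  exact hf.symm.trans ((congrArg _ h).trans hg)

/-- The working criterion for mates: every mate identified below is found by checking this single
equation of evaluations. -/
lemma mate_eq {f : X ⟶ Y} {g : Y' ⟶ X'} (h : g ▷ X ≫ ε_ X X' = Y' ◁ f ≫ ε_ Y Y') :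
    mate Y' X' f = g :=
  evaluation_injective ((mate_evaluation f).trans h.symm)

@[simp]
lemma mate_id : mate X' X' (𝟙 X) = 𝟙 X' := mate_eq (by simp)

lemma mate_comp (f : X ⟶ Y) (g : Y ⟶ Z) : mate Z' X' (f ≫ g) = mate Z' Y' g ≫ mate Y' X' f :=
  mate_eq (by
    rw [comp_whiskerRight, Category.assoc, mate_evaluation, ← whisker_exchange_assoc,
      mate_evaluation, MonoidalCategory.whiskerLeft_comp, Category.assoc])

/-- The mate of an isomorphism. -/
def mateIso (Y' X' : D) [ExactPairing X X'] [ExactPairing Y Y'] (f : X ≅ Y) : Y' ≅ X' where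
  hom := mate Y' X' f.hom
  inv := mate X' Y' f.inv
  hom_inv_id := by rw [← mate_comp, f.inv_hom_id, mate_id]
  inv_hom_id := by rw [← mate_comp, f.hom_inv_id, mate_id]

/-- The evaluation of a tensor product is nested. The pair `Z' ⊗ Z` sits inside and cancels without
meeting `f`, which then passes through the outer evaluation. -/
lemma mate_whiskerLeft (f : X ⟶ Y) :
    mate (Y' ⊗ Z') (X' ⊗ Z') (Z ◁ f) = mate Y' X' f ▷ Z' := mate_eq (by
  simp only [ExactPairing.tensor_evaluation]
  calc
    _ = 𝟙 _ ⊗≫ (mate Y' X' f ▷ (Z' ⊗ Z) ≫ X' ◁ ε_ Z Z') ▷ X ⊗≫ ε_ X X' := by monoidal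
    _ = 𝟙 _ ⊗≫ Y' ◁ ε_ Z Z' ▷ X ⊗≫ mate Y' X' f ▷ X ≫ ε_ X X' := by
      rw [← whisker_exchange]; monoidal
    _ = 𝟙 _ ⊗≫ Y' ◁ (ε_ Z Z' ▷ X ≫ 𝟙_ D ◁ f) ⊗≫ ε_ Y Y' := by rw [mate_evaluation]; monoidal
    _ = _ := by rw [← whisker_exchange]; monoidal)

lemma mate_whiskerRight (f : X ⟶ Y) :
    mate (Z' ⊗ Y') (Z' ⊗ X') (f ▷ Z) = Z' ◁ mate Y' X' f := mate_eq (by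
  simp only [ExactPairing.tensor_evaluation]
  calc
    _ = 𝟙 _ ⊗≫ Z' ◁ (mate Y' X' f ▷ X ≫ ε_ X X') ▷ Z ⊗≫ ε_ Z Z' := by monoidal
    _ = _ := by rw [mate_evaluation]; monoidal)

lemma mate_associator_hom : mate _ _ (α_ X Y Z).hom = (α_ Z' Y' X').hom := mate_eq (by
  simp only [ExactPairing.tensor_evaluation]
  monoidal)

lemma mate_associator_inv : mate _ _ (α_ X Y Z).inv = (α_ Z' Y' X').inv := mate_eq (by
  simp only [ExactPairing.tensor_evaluation]
  monoidal)

lemma unit_evaluation : ε_ (𝟙_ D) (𝟙_ D) = (ρ_ (𝟙_ D)).hom := rfl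

lemma mate_leftUnitor_hom : mate X' _ (λ_ X).hom = (ρ_ X').inv := mate_eq (by
  simp only [ExactPairing.tensor_evaluation, unit_evaluation]
  monoidal)

lemma mate_rightUnitor_hom : mate X' _ (ρ_ X).hom = (λ_ X').inv := mate_eq (by
  simp only [ExactPairing.tensor_evaluation, unit_evaluation]
  monoidal)

lemma mate_leftUnitor_inv : mate _ X' (λ_ X).inv = (ρ_ X').hom := mate_eq (by
  simp only [ExactPairing.tensor_evaluation, unit_evaluation]
  monoidal)

lemma mate_rightUnitor_inv : mate _ X' (ρ_ X).inv = (λ_ X').hom := mate_eq (by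
  simp only [ExactPairing.tensor_evaluation, unit_evaluation]
  monoidal)

lemma mate_tensor {W W' : D} [ExactPairing W W'] (f : X ⟶ Y) (g : Z ⟶ W) :
    mate (W' ⊗ Y') (Z' ⊗ X') (f ⊗ₘ g) = mate W' Z' g ⊗ₘ mate Y' X' f := by
  rw [MonoidalCategory.tensorHom_def, mate_comp (Y' := Z' ⊗ Y'), mate_whiskerLeft,
    mate_whiskerRight, ← MonoidalCategory.tensorHom_def]

end Mate

/-! ### Cups, caps and the symmetry -/

section Braided

variable {D : Type u} [Category.{v} D] [MonoidalCategory D] [SymmetricCategory D]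

/-- A wire can be moved to the other side of a cap: naturality of the braiding at `e` crosses both
legs, and the crossing with the second leg is undone by symmetry. The two lemmas on `c` are the same
fact for cups. -/
lemma braiding_evaluation_left {X X' : D} (Y : D) (e : X' ⊗ X ⟶ 𝟙_ D) :
    (β_ X' Y).hom ▷ X ⊗≫ Y ◁ e = 𝟙 _ ⊗≫ X' ◁ (β_ Y X).hom ⊗≫ e ▷ Y ⊗≫ 𝟙 _ := by
  have h := BraidedCategory.braiding_naturality_left e Y
  rw [BraidedCategory.braiding_tensor_left_hom, braiding_tensorUnit_left] at h
  calc
    _ = 𝟙 _ ⊗≫ X' ◁ ((β_ Y X).hom ≫ (β_ X Y).hom) ⊗≫ (β_ X' Y).hom ▷ X ⊗≫ Y ◁ e := by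
      rw [SymmetricCategory.symmetry]; monoidal
    _ = 𝟙 _ ⊗≫ X' ◁ (β_ Y X).hom ⊗≫ ((α_ X' X Y).hom ≫ X' ◁ (β_ X Y).hom ≫
          (α_ X' Y X).inv ≫ (β_ X' Y).hom ▷ X ≫ (α_ Y X' X).hom) ≫ Y ◁ e := by monoidal
    _ = _ := by rw [← h]; monoidal

lemma braiding_coevaluation_left {X X' : D} (Y : D) (c : 𝟙_ D ⟶ X' ⊗ X) :
    Y ◁ c ⊗≫ (β_ Y X').hom ▷ X = 𝟙 _ ⊗≫ c ▷ Y ⊗≫ X' ◁ (β_ X Y).hom ⊗≫ 𝟙 _ := by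
  have h := BraidedCategory.braiding_naturality_right Y c
  rw [BraidedCategory.braiding_tensor_right_hom, braiding_tensorUnit_right] at h
  calc
    _ = Y ◁ c ⊗≫ (β_ Y X').hom ▷ X ⊗≫ X' ◁ ((β_ Y X).hom ≫ (β_ X Y).hom) ⊗≫ 𝟙 _ := by
      rw [SymmetricCategory.symmetry]; monoidal
    _ = (Y ◁ c ≫ (α_ Y X' X).inv ≫ (β_ Y X').hom ▷ X ≫ (α_ X' Y X).hom ≫
          X' ◁ (β_ Y X).hom ≫ (α_ X' X Y).inv) ⊗≫ X' ◁ (β_ X Y).hom ⊗≫ 𝟙 _ := by monoidal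
    _ = _ := by rw [h]; monoidal

lemma braiding_coevaluation_right {X X' : D} (Y : D) (c : 𝟙_ D ⟶ X' ⊗ X) :
    c ▷ Y ⊗≫ X' ◁ (β_ X Y).hom = 𝟙 _ ⊗≫ Y ◁ c ⊗≫ (β_ Y X').hom ▷ X ⊗≫ 𝟙 _ := by
  calc
    _ = 𝟙 _ ⊗≫ (𝟙 (Y ⊗ 𝟙_ D) ⊗≫ c ▷ Y ⊗≫ X' ◁ (β_ X Y).hom ⊗≫ 𝟙 ((X' ⊗ Y) ⊗ X)) ⊗≫ 𝟙 _ := by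
      monoidal
    _ = _ := by rw [← braiding_coevaluation_left]; monoidal

/-- A cup created inside a cap and led out by crossings does not interact with it. Moving each
crossing to the other leg produces double crossings, which cancel. This is the interaction of
residuals in a composite learner. -/
lemma coevaluation_braiding_evaluation {P P' Q Q' : D} (c : 𝟙_ D ⟶ P' ⊗ P) (e : Q' ⊗ Q ⟶ 𝟙_ D) :
    𝟙 _ ⊗≫ Q' ◁ c ▷ Q ⊗≫ (β_ Q' P').hom ▷ (P ⊗ Q) ⊗≫ (P' ⊗ Q') ◁ (β_ P Q).hom ⊗≫
      P' ◁ e ▷ P ⊗≫ 𝟙 _ = e ≫ c := by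
  calc
    _ = 𝟙 _ ⊗≫ Q' ◁ c ▷ Q ⊗≫ ((β_ Q' P').hom ▷ (P ⊗ Q) ≫ (P' ⊗ Q') ◁ (β_ P Q).hom) ⊗≫
          P' ◁ e ▷ P ⊗≫ 𝟙 _ := by monoidal
    _ = 𝟙 _ ⊗≫ Q' ◁ (c ▷ Q ⊗≫ P' ◁ (β_ P Q).hom) ⊗≫ ((β_ Q' P').hom ▷ Q ⊗≫ P' ◁ e) ▷ P ⊗≫
          𝟙 _ := by rw [← whisker_exchange]; monoidal
    _ = 𝟙 _ ⊗≫ (Q' ⊗ Q) ◁ c ⊗≫ Q' ◁ ((β_ Q P').hom ≫ (β_ P' Q).hom) ▷ P ⊗≫ e ▷ (P' ⊗ P) ⊗≫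
          𝟙 _ := by rw [braiding_coevaluation_right, braiding_evaluation_left]; monoidal
    _ = 𝟙 _ ⊗≫ ((Q' ⊗ Q) ◁ c ≫ e ▷ (P' ⊗ P)) ⊗≫ 𝟙 _ := by
      rw [SymmetricCategory.symmetry]; monoidal
    _ = _ := by rw [whisker_exchange]; monoidal

section

variable {X Y X' Y' : D} [ExactPairing X X'] [ExactPairing Y Y']

/-- Each cap in turn is slid along the wires of the other, which trades a crossing of dual wires for
a crossing of the original ones. -/
lemma mate_braiding_hom : mate _ _ (β_ X Y).hom = (β_ X' Y').hom := mate_eq (by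
  simp only [ExactPairing.tensor_evaluation]
  calc
    _ = 𝟙 _ ⊗≫ ((β_ X' Y').hom ▷ X ⊗≫ Y' ◁ ε_ X X') ▷ Y ⊗≫ ε_ Y Y' := by monoidal
    _ = 𝟙 _ ⊗≫ X' ◁ (β_ Y' X).hom ▷ Y ⊗≫ (ε_ X X' ▷ (Y' ⊗ Y) ≫ 𝟙_ D ◁ ε_ Y Y') ⊗≫ 𝟙 _ := by
      rw [braiding_evaluation_left]; monoidal
    _ = 𝟙 _ ⊗≫ X' ◁ ((β_ Y' X).hom ▷ Y ⊗≫ X ◁ ε_ Y Y') ⊗≫ ε_ X X' := by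
      rw [← whisker_exchange]; monoidal
    _ = _ := by rw [braiding_evaluation_left]; monoidal)

/-- The coevaluation `I ⟶ X' ⊗ X` of the reversed pairing. -/
def cup (X X' : D) [ExactPairing X X'] : 𝟙_ D ⟶ X' ⊗ X := η_ X X' ≫ (β_ X X').hom

lemma cup_mate (f : X ⟶ Y) : cup Y Y' ≫ mate Y' X' f ▷ Y = cup X X' ≫ X' ◁ f := by
  rw [cup, Category.assoc, ← BraidedCategory.braiding_naturality_right,
    reassoc_of% coevaluation_mate (X' := X') (Y' := Y') f,
    BraidedCategory.braiding_naturality_left, cup, Category.assoc]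

/-- Reversing the pairing exchanges the nesting: in `η_` the pair of `Y` lies inside that of `X`, in
`cup` the pair of `X` lies inside that of `Y`. Naturality of the braiding moves the two pairs past
each other. -/
lemma cup_tensor : cup (X ⊗ Y) (Y' ⊗ X') = cup Y Y' ⊗≫ Y' ◁ cup X X' ▷ Y ⊗≫ 𝟙 _ := by
  simp only [cup, ExactPairing.tensor_coevaluation, BraidedCategory.braiding_tensor_left_hom,
    BraidedCategory.braiding_tensor_right_hom]
  have h := BraidedCategory.braiding_naturality_right Y (η_ X X')
  rw [BraidedCategory.braiding_tensor_right_hom, braiding_tensorUnit_right] at h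
  calc
    _ = η_ X X' ⊗≫ (X ◁ (η_ Y Y' ≫ (β_ Y Y').hom) ⊗≫ (β_ X Y').hom ▷ Y) ▷ X' ⊗≫
          Y' ◁ X ◁ (β_ Y X').hom ⊗≫ Y' ◁ (β_ X X').hom ▷ Y ⊗≫ 𝟙 _ := by monoidal
    _ = 𝟙 _ ⊗≫ (𝟙_ D ◁ η_ X X' ≫ (η_ Y Y' ≫ (β_ Y Y').hom) ▷ (X ⊗ X')) ⊗≫
          Y' ◁ (β_ Y X).hom ▷ X' ⊗≫
          Y' ◁ X ◁ (β_ Y X').hom ⊗≫ Y' ◁ (β_ X X').hom ▷ Y ⊗≫ 𝟙 _ := by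
      rw [braiding_coevaluation_left]; monoidal
    _ = (η_ Y Y' ≫ (β_ Y Y').hom) ⊗≫ Y' ◁ (Y ◁ η_ X X' ≫ (α_ Y X X').inv ≫ (β_ Y X).hom ▷ X' ≫
          (α_ X Y X').hom ≫ X ◁ (β_ Y X').hom ≫ (α_ X X' Y).inv) ⊗≫ Y' ◁ (β_ X X').hom ▷ Y ⊗≫
          𝟙 _ := by
      rw [whisker_exchange]; monoidal
    _ = _ := by rw [h]; monoidal

/-! ### Contraction of residuals, its dinaturality and composition -/

/-- Creates a pair `P' ⊗ P` in the middle of `A' ⊗ A`. -/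
def insertPair (A' A P P' : D) [ExactPairing P P'] : A' ⊗ A ⟶ (A' ⊗ P') ⊗ (P ⊗ A) :=
  A' ◁ ((λ_ A).inv ≫ cup P P' ▷ A ≫ (α_ P' P A).hom) ≫ (α_ A' P' (P ⊗ A)).inv

/-- Cancels a pair `Q' ⊗ Q` in the middle of `B' ⊗ Q' ⊗ Q ⊗ B`. -/
def cancelPair (B' B Q Q' : D) [ExactPairing Q Q'] : (B' ⊗ Q') ⊗ (Q ⊗ B) ⟶ B' ⊗ B :=
  (α_ B' Q' (Q ⊗ B)).hom ≫ B' ◁ ((α_ Q' Q B).inv ≫ ε_ Q Q' ▷ B ≫ (λ_ B).hom)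

/-- Applies `s` and `l` next to a created pair `P' ⊗ P` and cancels the resulting pair
`Q' ⊗ Q`. -/
def contract {A A' B B' P P' Q Q' : D} [ExactPairing P P'] [ExactPairing Q Q']
    (l : P ⊗ A ⟶ Q ⊗ B) (s : A' ⊗ P' ⟶ B' ⊗ Q') : A' ⊗ A ⟶ B' ⊗ B :=
  insertPair A' A P P' ≫ (s ⊗ₘ l) ≫ cancelPair B' B Q Q'

/-- `p` travels through the cup by `cup_mate`, and `q` through the cap by `mate_evaluation`. This is
what makes the construction well defined on the coend. -/
lemma contract_slide {A A' B B' P P' Q Q' R R' S S' : D} [ExactPairing P P'] [ExactPairing Q Q']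
    [ExactPairing R R'] [ExactPairing S S'] (p : P ⟶ R) (q : Q ⟶ S)
    (l : R ⊗ A ⟶ Q ⊗ B) (s : A' ⊗ P' ⟶ B' ⊗ S') :
    contract (p ▷ A ≫ l) (s ≫ B' ◁ mate S' Q' q) =
      contract (l ≫ q ▷ B) (A' ◁ mate R' P' p ≫ s) := by
  have h1 : insertPair A' A P P' ≫ (A' ⊗ P') ◁ p ▷ A =
      insertPair A' A R R' ≫ (A' ◁ mate R' P' p) ▷ (R ⊗ A) := by
    simp only [insertPair]
    calc
      _ = 𝟙 _ ⊗≫ A' ◁ (cup P P' ≫ P' ◁ p) ▷ A ⊗≫ 𝟙 _ := by monoidal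
      _ = _ := by rw [← cup_mate (Y' := R')]; monoidal
  have h2 : (B' ◁ mate S' Q' q) ▷ (Q ⊗ B) ≫ cancelPair B' B Q Q' =
      (B' ⊗ S') ◁ q ▷ B ≫ cancelPair B' B S S' := by
    simp only [cancelPair]
    calc
      _ = 𝟙 _ ⊗≫ B' ◁ (mate S' Q' q ▷ Q ≫ ε_ Q Q') ▷ B ⊗≫ 𝟙 _ := by monoidal
      _ = _ := by rw [mate_evaluation]; monoidal
  rw [contract, ← whiskerLeft_comp_tensorHom, ← tensorHom_comp_whiskerRight, Category.assoc,
    Category.assoc, h2,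
    reassoc_of% h1, contract, ← whiskerRight_comp_tensorHom, ← tensorHom_comp_whiskerLeft,
    Category.assoc, Category.assoc]

/-- The mirror image of `Cell.comp`. -/
def coComp {A B E P₁ P₂ Q₁ Q₂ : D} (s₁ : A ⊗ P₁ ⟶ B ⊗ Q₁) (s₂ : B ⊗ P₂ ⟶ E ⊗ Q₂) :
    A ⊗ (P₁ ⊗ P₂) ⟶ E ⊗ (Q₂ ⊗ Q₁) :=
  (α_ _ _ _).inv ≫ s₁ ▷ P₂ ≫ (α_ _ _ _).hom ≫ B ◁ (β_ Q₁ P₂).hom ≫ (α_ _ _ _).inv ≫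
    s₂ ▷ Q₁ ≫ (α_ _ _ _).hom

lemma contract_comp {A A' B B' E E' P₁ P₁' P₂ P₂' Q₁ Q₁' Q₂ Q₂' : D} [ExactPairing P₁ P₁']
    [ExactPairing P₂ P₂'] [ExactPairing Q₁ Q₁'] [ExactPairing Q₂ Q₂']
    (l₁ : P₁ ⊗ A ⟶ Q₁ ⊗ B) (s₁ : A' ⊗ P₁' ⟶ B' ⊗ Q₁')
    (l₂ : P₂ ⊗ B ⟶ Q₂ ⊗ E) (s₂ : B' ⊗ P₂' ⟶ E' ⊗ Q₂') :
    contract (Cell.comp l₁ l₂) (coComp s₁ s₂) = contract l₁ s₁ ≫ contract l₂ s₂ := by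
  -- The pair of `P₂` is nested inside that of `P₁`, so its creation can be delayed until `s₁` and
  -- `l₁` have acted.
  have h1 : insertPair A' A (P₂ ⊗ P₁) (P₁' ⊗ P₂') ≫
      (((α_ _ _ _).inv ≫ s₁ ▷ P₂') ⊗ₘ ((α_ _ _ _).hom ≫ P₂ ◁ l₁)) =
      insertPair A' A P₁ P₁' ≫ (s₁ ⊗ₘ l₁) ≫ insertPair (B' ⊗ Q₁') (Q₁ ⊗ B) P₂ P₂' := by
    simp only [insertPair, cup_tensor, MonoidalCategory.tensorHom_def]
    calc
      _ = 𝟙 _ ⊗≫ A' ◁ cup P₁ P₁' ▷ A ⊗≫ ((A' ⊗ P₁') ◁ (cup P₂ P₂' ▷ (P₁ ⊗ A)) ≫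
            s₁ ▷ ((P₂' ⊗ P₂) ⊗ (P₁ ⊗ A))) ⊗≫ (B' ⊗ Q₁') ◁ ((P₂' ⊗ P₂) ◁ l₁) ⊗≫ 𝟙 _ := by
        monoidal
      _ = 𝟙 _ ⊗≫ A' ◁ cup P₁ P₁' ▷ A ⊗≫ s₁ ▷ (P₁ ⊗ A) ⊗≫ (B' ⊗ Q₁') ◁ (cup P₂ P₂' ▷ (P₁ ⊗ A) ≫
            (P₂' ⊗ P₂) ◁ l₁) ⊗≫ 𝟙 _ := by
        rw [whisker_exchange]; monoidal
      _ = _ := by rw [← whisker_exchange]; monoidal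
  -- Dually, the pair of `Q₁` is innermost and can be cancelled before `s₂` and `l₂` act.
  have h2 : ((s₂ ▷ Q₁' ≫ (α_ _ _ _).hom) ⊗ₘ (Q₁ ◁ l₂ ≫ (α_ _ _ _).inv)) ≫
      cancelPair E' E (Q₁ ⊗ Q₂) (Q₂' ⊗ Q₁') =
      cancelPair (B' ⊗ P₂') (P₂ ⊗ B) Q₁ Q₁' ≫ (s₂ ⊗ₘ l₂) ≫ cancelPair E' E Q₂ Q₂' := by
    simp only [cancelPair, ExactPairing.tensor_evaluation, MonoidalCategory.tensorHom_def']
    calc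
      _ = 𝟙 _ ⊗≫ (B' ⊗ P₂') ◁ ((Q₁' ⊗ Q₁) ◁ l₂) ⊗≫ (s₂ ▷ ((Q₁' ⊗ Q₁) ⊗ (Q₂ ⊗ E)) ≫
            (E' ⊗ Q₂') ◁ (ε_ Q₁ Q₁' ▷ (Q₂ ⊗ E))) ⊗≫ E' ◁ ε_ Q₂ Q₂' ▷ E ⊗≫ 𝟙 _ := by monoidal
      _ = 𝟙 _ ⊗≫ (B' ⊗ P₂') ◁ ((Q₁' ⊗ Q₁) ◁ l₂ ≫ ε_ Q₁ Q₁' ▷ (Q₂ ⊗ E)) ⊗≫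
            s₂ ▷ (Q₂ ⊗ E) ⊗≫ E' ◁ ε_ Q₂ Q₂' ▷ E ⊗≫ 𝟙 _ := by
        rw [← whisker_exchange]; monoidal
      _ = _ := by rw [whisker_exchange]; monoidal
  -- Only the swaps of `P₂` past `Q₁` and of their duals remain between the creation of `P₂` and the
  -- cancellation of `Q₁`.
  have h3 : insertPair (B' ⊗ Q₁') (Q₁ ⊗ B) P₂ P₂' ≫
      (((α_ _ _ _).hom ≫ B' ◁ (β_ Q₁' P₂').hom ≫ (α_ _ _ _).inv) ⊗ₘ
        ((α_ _ _ _).inv ≫ (β_ P₂ Q₁).hom ▷ B ≫ (α_ _ _ _).hom)) ≫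
      cancelPair (B' ⊗ P₂') (P₂ ⊗ B) Q₁ Q₁' = cancelPair B' B Q₁ Q₁' ≫ insertPair B' B P₂ P₂' := by
    have h := coevaluation_braiding_evaluation (cup P₂ P₂') (ε_ Q₁ Q₁')
    simp only [insertPair, cancelPair, MonoidalCategory.tensorHom_def]
    calc
      _ = 𝟙 _ ⊗≫ B' ◁ (𝟙 (Q₁' ⊗ Q₁) ⊗≫ Q₁' ◁ cup P₂ P₂' ▷ Q₁ ⊗≫ (β_ Q₁' P₂').hom ▷ (P₂ ⊗ Q₁) ⊗≫
            (P₂' ⊗ Q₁') ◁ (β_ P₂ Q₁).hom ⊗≫ P₂' ◁ ε_ Q₁ Q₁' ▷ P₂ ⊗≫ 𝟙 (P₂' ⊗ P₂)) ▷ B ⊗≫ 𝟙 _ := by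
          monoidal
      _ = _ := by rw [h]; monoidal
  have hl : Cell.comp l₁ l₂ = ((α_ _ _ _).hom ≫ P₂ ◁ l₁) ≫ ((α_ _ _ _).inv ≫
      (β_ P₂ Q₁).hom ▷ B ≫ (α_ _ _ _).hom) ≫ (Q₁ ◁ l₂ ≫ (α_ _ _ _).inv) := by
    simp [Cell.comp, Cell.lwhisker]
  have hs : coComp s₁ s₂ = ((α_ _ _ _).inv ≫ s₁ ▷ P₂') ≫ ((α_ _ _ _).hom ≫
      B' ◁ (β_ Q₁' P₂').hom ≫ (α_ _ _ _).inv) ≫ (s₂ ▷ Q₁' ≫ (α_ _ _ _).hom) := by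
    simp [coComp]
  rw [contract, hl, hs, ← tensorHom_comp_tensorHom ((α_ _ _ _).inv ≫ s₁ ▷ P₂'),
    ← tensorHom_comp_tensorHom ((α_ _ _ _).hom ≫ _), Category.assoc, Category.assoc, h2,
    reassoc_of% h1, reassoc_of% h3]
  simp only [contract, Category.assoc]

/-- Mates reverse composites and exchange left and right whiskering, so the string diagram of
`Cell.comp` is turned into its mirror image, with the braiding again a braiding. -/
lemma mate_comp_cell {B B' E E' A A' P₁ P₁' P₂ P₂' Q₁ Q₁' Q₂ Q₂' : D} [ExactPairing P₁ P₁']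
    [ExactPairing P₂ P₂'] [ExactPairing Q₁ Q₁'] [ExactPairing Q₂ Q₂'] [ExactPairing A A']
    [ExactPairing B B'] [ExactPairing E E'] (r₂ : Q₂ ⊗ E ⟶ P₂ ⊗ B) (r₁ : Q₁ ⊗ B ⟶ P₁ ⊗ A) :
    mate (A' ⊗ (P₁' ⊗ P₂')) (E' ⊗ (Q₂' ⊗ Q₁')) (Cell.comp r₂ r₁) =
      coComp (mate (A' ⊗ P₁') (B' ⊗ Q₁') r₁) (mate (B' ⊗ P₂') (E' ⊗ Q₂') r₂) := by
  have h1 : mate (B' ⊗ (Q₁' ⊗ P₂')) (B' ⊗ (P₂' ⊗ Q₁')) ((β_ Q₁ P₂).hom ▷ B) =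
      B' ◁ (β_ Q₁' P₂').hom := by rw [mate_whiskerRight, mate_braiding_hom]
  simp only [Cell.comp, Cell.lwhisker, Category.assoc]
  -- A mate depends on the chosen pairings, so the dual of each intermediate object is prescribed.
  rw [mate_comp (Y' := (E' ⊗ Q₂') ⊗ Q₁'), mate_comp (Y' := (B' ⊗ P₂') ⊗ Q₁'),
    mate_comp (Y' := B' ⊗ (P₂' ⊗ Q₁')), mate_comp (Y' := B' ⊗ (Q₁' ⊗ P₂')),
    mate_comp (Y' := (B' ⊗ Q₁') ⊗ P₂'), mate_comp (Y' := (A' ⊗ P₁') ⊗ P₂')]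
  rw [mate_associator_hom, mate_whiskerLeft, mate_associator_inv, h1, mate_associator_hom,
    mate_whiskerLeft, mate_associator_inv]
  simp only [coComp, Category.assoc]

end

end Braided

end CompactClosed

/-! ### Contraction under change of residuals and under tensor -/

namespace CompactClosed

variable {D : Type u} [Category.{v} D] [MonoidalCategory D] [SymmetricCategory D]

/-- Sliding `p` and `q` to the opposite components makes them meet their inverses. This is used to
replace residuals such as `F(P₂ ⊗ P₁)` by `FP₂ ⊗ FP₁`, or `FI` by the unit. -/
lemma contract_iso {A A' B B' P P' Q Q' R R' S S' : D} [ExactPairing P P'] [ExactPairing Q Q']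
    [ExactPairing R R'] [ExactPairing S S'] (p : P ≅ R) (q : Q ≅ S)
    (l : R ⊗ A ⟶ S ⊗ B) (s : A' ⊗ R' ⟶ B' ⊗ S') :
    contract (p.hom ▷ A ≫ l ≫ q.inv ▷ B) (A' ◁ mate P' R' p.inv ≫ s ≫ B' ◁ mate S' Q' q.hom) =
      contract l s := by
  have h1 := contract_slide (R' := R') (Q' := Q') p.hom q.hom (l ≫ q.inv ▷ B)
    (A' ◁ mate P' R' p.inv ≫ s)
  rw [Category.assoc] at h1
  rw [h1, ← MonoidalCategory.whiskerLeft_comp_assoc, ← mate_comp (Y' := P')]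
  simp

lemma contract_mate_iso {A A₁ A' B B₁ B' P P' Q Q' R R' S S' : D} [ExactPairing P P']
    [ExactPairing Q Q'] [ExactPairing R R'] [ExactPairing S S'] [ExactPairing A₁ A']
    [ExactPairing B₁ B'] (p : P ≅ R) (q : Q ≅ S) (l : R ⊗ A ⟶ S ⊗ B) (r : S ⊗ B₁ ⟶ R ⊗ A₁) :
    contract (p.hom ▷ A ≫ l ≫ q.inv ▷ B)
      (mate (A' ⊗ P') (B' ⊗ Q') (q.hom ▷ B₁ ≫ r ≫ p.inv ▷ A₁)) =
      contract l (mate (A' ⊗ R') (B' ⊗ S') r) := by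
  rw [mate_comp (Y' := B' ⊗ S'), mate_comp (Y' := A' ⊗ R'), mate_whiskerRight, mate_whiskerRight,
    Category.assoc, contract_iso]

lemma contract_mate_slide {A A₁ A' B B₁ B' P P' Q Q' R R' S S' : D} [ExactPairing P P']
    [ExactPairing Q Q'] [ExactPairing R R'] [ExactPairing S S'] [ExactPairing A₁ A']
    [ExactPairing B₁ B'] (p : P ⟶ R) (q : Q ⟶ S) (l : R ⊗ A ⟶ Q ⊗ B) (r : S ⊗ B₁ ⟶ P ⊗ A₁) :
    contract (p ▷ A ≫ l) (mate (A' ⊗ P') (B' ⊗ Q') (q ▷ B₁ ≫ r)) =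
      contract (l ≫ q ▷ B) (mate (A' ⊗ R') (B' ⊗ S') (r ≫ p ▷ A₁)) := by
  rw [mate_comp (Y' := B' ⊗ S'), mate_comp (Y' := A' ⊗ P'), mate_whiskerRight, mate_whiskerRight,
    contract_slide (R' := R') (Q' := Q')]

/-- The outer wires never touch the created and cancelled pairs, so the interchange law moves `f`,
`f'`, `g`, `g'` outside. -/
lemma contract_wires {A A' B B' A₁ A₁' B₁ B₁' P P' Q Q' : D} [ExactPairing P P']
    [ExactPairing Q Q'] (f : A₁ ⟶ A) (f' : A₁' ⟶ A') (g : B ⟶ B₁) (g' : B' ⟶ B₁')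
    (l : P ⊗ A ⟶ Q ⊗ B) (s : A' ⊗ P' ⟶ B' ⊗ Q') :
    contract (P ◁ f ≫ l ≫ Q ◁ g) (f' ▷ P' ≫ s ≫ g' ▷ Q') =
      (f' ⊗ₘ f) ≫ contract l s ≫ (g' ⊗ₘ g) := by
  have h1 : insertPair A₁' A₁ P P' ≫ (f' ▷ P' ⊗ₘ P ◁ f) = (f' ⊗ₘ f) ≫ insertPair A' A P P' := by
    simp only [insertPair, MonoidalCategory.tensorHom_def]
    calc
      _ = 𝟙 _ ⊗≫ (A₁' ◁ (cup P P' ▷ A₁) ≫ f' ▷ ((P' ⊗ P) ⊗ A₁)) ⊗≫ A' ◁ ((P' ⊗ P) ◁ f) ⊗≫ 𝟙 _ := by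
        monoidal
      _ = 𝟙 _ ⊗≫ f' ▷ A₁ ⊗≫ A' ◁ (cup P P' ▷ A₁ ≫ (P' ⊗ P) ◁ f) ⊗≫ 𝟙 _ := by
        rw [whisker_exchange]; monoidal
      _ = _ := by rw [← whisker_exchange]; monoidal
  have h2 : (g' ▷ Q' ⊗ₘ Q ◁ g) ≫ cancelPair B₁' B₁ Q Q' = cancelPair B' B Q Q' ≫ (g' ⊗ₘ g) := by
    simp only [cancelPair, MonoidalCategory.tensorHom_def']
    calc
      _ = 𝟙 _ ⊗≫ B' ◁ ((Q' ⊗ Q) ◁ g) ⊗≫ (g' ▷ ((Q' ⊗ Q) ⊗ B₁) ≫ B₁' ◁ (ε_ Q Q' ▷ B₁)) ⊗≫ 𝟙 _ := by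
        monoidal
      _ = 𝟙 _ ⊗≫ B' ◁ ((Q' ⊗ Q) ◁ g ≫ ε_ Q Q' ▷ B₁) ⊗≫ g' ▷ B₁ ⊗≫ 𝟙 _ := by
        rw [← whisker_exchange]; monoidal
      _ = _ := by rw [whisker_exchange]; monoidal
  rw [contract, ← tensorHom_comp_tensorHom, ← tensorHom_comp_tensorHom s, Category.assoc,
    Category.assoc, h2, reassoc_of% h1, contract, Category.assoc, Category.assoc]

lemma cup_unit : cup (𝟙_ D) (𝟙_ D) = (ρ_ (𝟙_ D)).inv := by
  change (ρ_ (𝟙_ D)).inv ≫ _ = _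
  rw [braiding_tensorUnit_left]; monoidal

lemma contract_unit {A A' B B' : D} (f : A ⟶ B) (g : A' ⟶ B') :
    contract (𝟙_ D ◁ f) (g ▷ 𝟙_ D) = g ⊗ₘ f := by
  simp only [contract, insertPair, cancelPair, cup_unit, unit_evaluation]
  monoidal

/-- A closed loop on `J` is trivial once `J` is isomorphic to the unit. The isomorphism is needed
because the case of interest is `J = FI`. -/
lemma contract_wire {A A' B B' J J' : D} [ExactPairing J J'] (j : J ≅ 𝟙_ D) (f : A ⟶ B)
    (g : A' ⟶ B') : contract (J ◁ f) (g ▷ J') = g ⊗ₘ f := by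
  rw [← contract_unit, ← contract_iso (P' := J') (Q' := J') (R' := 𝟙_ D) (S' := 𝟙_ D) j j]
  congr 1
  · rw [← whisker_exchange_assoc, ← comp_whiskerRight, j.hom_inv_id]; simp
  · rw [← whisker_exchange, ← MonoidalCategory.whiskerLeft_comp_assoc, ← mate_comp, j.hom_inv_id]
    simp

/-- The cell `l` next to a wire `Y` on its right. -/
def whiskerCell {P A Q B : D} (l : P ⊗ A ⟶ Q ⊗ B) (Y : D) : P ⊗ (A ⊗ Y) ⟶ Q ⊗ (B ⊗ Y) :=
  (α_ _ _ _).inv ≫ l ▷ Y ≫ (α_ _ _ _).hom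

/-- The cell `r` with a wire `Y` passing between its residual and its other wire. -/
def switchCell {P A Q B : D} (r : Q ⊗ B ⟶ P ⊗ A) (Y : D) : Q ⊗ (Y ⊗ B) ⟶ P ⊗ (Y ⊗ A) :=
  (α_ _ _ _).inv ≫ (β_ Q Y).hom ▷ B ≫ (α_ _ _ _).hom ≫ Y ◁ r ≫ (α_ _ _ _).inv ≫
    (β_ Y P).hom ▷ A ≫ (α_ _ _ _).hom

/-- The mirror image of `switchCell`. -/
def coSwitchCell {P A Q B : D} (s : A ⊗ P ⟶ B ⊗ Q) (Y : D) : (A ⊗ Y) ⊗ P ⟶ (B ⊗ Y) ⊗ Q :=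
  (α_ _ _ _).hom ≫ A ◁ (β_ Y P).hom ≫ (α_ _ _ _).inv ≫ s ▷ Y ≫ (α_ _ _ _).hom ≫
    B ◁ (β_ Q Y).hom ≫ (α_ _ _ _).inv

lemma mate_switchCell {P P' Q Q' A A' B B' Y Y' : D} [ExactPairing P P']
    [ExactPairing Q Q'] [ExactPairing A A'] [ExactPairing B B'] [ExactPairing Y Y']
    (r : Q ⊗ B ⟶ P ⊗ A) : mate ((A' ⊗ Y') ⊗ P') ((B' ⊗ Y') ⊗ Q') (switchCell r Y) =
      coSwitchCell (mate (A' ⊗ P') (B' ⊗ Q') r) Y' := by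
  have h1 : mate (B' ⊗ (Q' ⊗ Y')) (B' ⊗ (Y' ⊗ Q')) ((β_ Q Y).hom ▷ B) =
      B' ◁ (β_ Q' Y').hom := by rw [mate_whiskerRight, mate_braiding_hom]
  have h2 : mate (A' ⊗ (Y' ⊗ P')) (A' ⊗ (P' ⊗ Y')) ((β_ Y P).hom ▷ A) =
      A' ◁ (β_ Y' P').hom := by rw [mate_whiskerRight, mate_braiding_hom]
  simp only [switchCell]
  rw [mate_comp (Y' := B' ⊗ (Y' ⊗ Q')), mate_comp (Y' := B' ⊗ (Q' ⊗ Y')),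
    mate_comp (Y' := (B' ⊗ Q') ⊗ Y'), mate_comp (Y' := (A' ⊗ P') ⊗ Y'),
    mate_comp (Y' := A' ⊗ (P' ⊗ Y')), mate_comp (Y' := A' ⊗ (Y' ⊗ P')), h1, h2]
  rw [mate_associator_hom, mate_whiskerLeft, mate_associator_inv, mate_associator_hom,
    mate_associator_inv]
  simp only [coSwitchCell, Category.assoc]

/-- The interchange carries `Y'` into the region where residuals are created and cancelled. It can
cross a whole cup or cap at once, leaving on the other leg exactly the crossings of `coSwitchCell`.
-/
lemma contract_whiskerRight {A A' B B' P P' Q Q' : D} [ExactPairing P P'] [ExactPairing Q Q']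
    (l : P ⊗ A ⟶ Q ⊗ B) (s : A' ⊗ P' ⟶ B' ⊗ Q') (Y' Y : D) :
    contract l s ▷ (Y' ⊗ Y) ≫ tensorμ B' B Y' Y =
      tensorμ A' A Y' Y ≫ contract (whiskerCell l Y) (coSwitchCell s Y') := by
  -- The wire `Y'` is moved across the newly created pair `P' ⊗ P`.
  have h1 : tensorμ A' A Y' Y ≫ insertPair (A' ⊗ Y') (A ⊗ Y) P P' ≫
      (((α_ _ _ _).hom ≫ A' ◁ (β_ Y' P').hom ≫ (α_ _ _ _).inv) ⊗ₘ (α_ _ _ _).inv) =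
      insertPair A' A P P' ▷ (Y' ⊗ Y) ≫ tensorμ (A' ⊗ P') (P ⊗ A) Y' Y := by
    simp only [tensorμ, insertPair, BraidedCategory.braiding_tensor_left_hom]
    calc
      _ = 𝟙 _ ⊗≫ A' ◁ (𝟙_ D ◁ (β_ A Y').hom ≫ cup P P' ▷ (Y' ⊗ A)) ▷ Y ⊗≫
            A' ◁ P' ◁ (β_ P Y').hom ▷ A ▷ Y ⊗≫ 𝟙 _ := by
        rw [whisker_exchange]
        calc
          _ = 𝟙 _ ⊗≫ A' ◁ (β_ A Y').hom ▷ Y ⊗≫ A' ◁ (Y' ◁ cup P P' ⊗≫ (β_ Y' P').hom ▷ P) ▷ A ▷ Y ⊗≫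
            𝟙 _ := by monoidal
          _ = _ := by
            rw [braiding_coevaluation_left, ← whisker_exchange]; monoidal
      _ = _ := by rw [whisker_exchange]; monoidal
  -- The wire `Y'` crosses `Q` twice, and symmetry removes the double crossing before `Q' ⊗ Q` is
  -- cancelled.
  have h2 : tensorμ (B' ⊗ Q') (Q ⊗ B) Y' Y ≫
      (((α_ _ _ _).hom ≫ B' ◁ (β_ Q' Y').hom ≫ (α_ _ _ _).inv) ⊗ₘ (α_ _ _ _).hom) ≫
      cancelPair (B' ⊗ Y') (B ⊗ Y) Q Q' = cancelPair B' B Q Q' ▷ (Y' ⊗ Y) ≫ tensorμ B' B Y' Y := by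
    simp only [tensorμ, cancelPair, BraidedCategory.braiding_tensor_left_hom]
    calc
      _ = 𝟙 _ ⊗≫ B' ◁ Q' ◁ Q ◁ (β_ B Y').hom ▷ Y ⊗≫ B' ◁ Q' ◁ (β_ Q Y').hom ▷ B ▷ Y ⊗≫
            B' ◁ ((β_ Q' Y').hom ▷ Q ⊗≫ Y' ◁ ε_ Q Q') ▷ B ▷ Y ⊗≫ 𝟙 _ := by monoidal
      _ = 𝟙 _ ⊗≫ B' ◁ ((Q' ⊗ Q) ◁ (β_ B Y').hom) ▷ Y ⊗≫
            B' ◁ Q' ◁ ((β_ Q Y').hom ≫ (β_ Y' Q).hom) ▷ B ▷ Y ⊗≫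
            B' ◁ (ε_ Q Q' ▷ (Y' ⊗ B)) ▷ Y ⊗≫ 𝟙 _ := by
        rw [braiding_evaluation_left]; monoidal
      _ = 𝟙 _ ⊗≫ B' ◁ ((Q' ⊗ Q) ◁ (β_ B Y').hom ≫ ε_ Q Q' ▷ (Y' ⊗ B)) ▷ Y ⊗≫ 𝟙 _ := by
        rw [SymmetricCategory.symmetry]; monoidal
      _ = _ := by rw [whisker_exchange]; monoidal
  have hs : coSwitchCell s Y' = ((α_ _ _ _).hom ≫ A' ◁ (β_ Y' P').hom ≫ (α_ _ _ _).inv) ≫ s ▷ Y' ≫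
      ((α_ _ _ _).hom ≫ B' ◁ (β_ Q' Y').hom ≫ (α_ _ _ _).inv) := by simp [coSwitchCell]
  rw [contract, contract, hs, whiskerCell, ← tensorHom_comp_tensorHom,
    ← tensorHom_comp_tensorHom (s ▷ Y'), Category.assoc, Category.assoc, reassoc_of% h1,
    ← tensorμ_natural_left_assoc, h2]
  simp only [comp_whiskerRight, Category.assoc]

end CompactClosed

/-! ### Whiskering a learner by an object -/

namespace Learn

open CompactClosed

variable {C : Type u} [Category.{v} C] [MonoidalCategory C] [SymmetricCategory C]

/-- The identity contributes unit residuals, and the coend relation absorbs them along the right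
unitors of `P` and `Q`. What is left is a representative with the original residuals, to which
`contract_whiskerRight` applies. -/
lemma hom_whiskerRight {X Y : Learn C} {P Q : C} (l : P ⊗ X.fst ⟶ Q ⊗ Y.fst)
    (r : Q ⊗ Y.snd ⟶ P ⊗ X.snd) (Z : Learn C) :
    (hom l r : X ⟶ Y) ▷ Z =
      (hom (whiskerCell l Z.fst) (switchCell r Z.snd) : (X ⊗ Z : Learn C) ⟶ (Y ⊗ Z : Learn C)) := by
  have hμ : ∀ P A Y : C, tensorμ P (𝟙_ C) A Y ≫ (P ⊗ A) ◁ (λ_ Y).hom =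
      (ρ_ P).hom ▷ (A ⊗ Y) ≫ (α_ P A Y).inv := fun P A Y => by
    simp only [tensorμ, braiding_tensorUnit_left]; monoidal
  have ht : ∀ {P A Q B : C} (l : P ⊗ A ⟶ Q ⊗ B) (Y : C),
      Cell.tens l (𝟙 (𝟙_ C ⊗ Y)) ≫ (ρ_ Q).hom ▷ (B ⊗ Y) = (ρ_ P).hom ▷ (A ⊗ Y) ≫ whiskerCell l Y :=
    fun {P A Q B} l Y => by
      rw [← cancel_mono (α_ Q B Y).inv, Category.assoc, ← hμ, reassoc_of% @Cell.tens_tensorμ,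
        tensorHom_id, ← whisker_exchange, reassoc_of% hμ]
      simp [whiskerCell]
  have hs : ∀ {P A Q B : C} (r : P ⊗ A ⟶ Q ⊗ B) (Y : C),
      Cell.tensSwap r (𝟙 (𝟙_ C ⊗ Y)) ≫ (ρ_ Q).hom ▷ (Y ⊗ B) =
        (ρ_ P).hom ▷ (Y ⊗ A) ≫ switchCell r Y := fun {P A Q B} r Y => by
    -- The order-reversing swaps in `tensSwap` combine with moving `Y` across the whole cell,
    -- leaving only the crossing of `Y` with the residual; `h2` is the counterpart at the output.
    have h1 : (α_ P Y A).inv ≫ (β_ P Y).hom ▷ A ≫ (α_ Y P A).hom =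
        P ◁ (β_ Y A).hom ≫ (α_ P A Y).inv ≫ (β_ (P ⊗ A) Y).hom := by
      rw [BraidedCategory.braiding_tensor_left_hom, Iso.inv_hom_id_assoc,
        ← MonoidalCategory.whiskerLeft_comp_assoc, SymmetricCategory.symmetry]
      simp
    have h2 : (β_ (Q ⊗ B) Y).hom ≫ (α_ Y Q B).inv ≫ (β_ Y Q).hom ▷ B ≫ (α_ Q Y B).hom =
        (α_ Q B Y).hom ≫ Q ◁ (β_ B Y).hom := by
      rw [BraidedCategory.braiding_tensor_left_hom]
      simp only [Category.assoc, Iso.hom_inv_id_assoc, ← comp_whiskerRight_assoc,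
        SymmetricCategory.symmetry]
      simp
    rw [Cell.tensSwap, Category.assoc, Category.assoc, whisker_exchange, reassoc_of% ht,
      whisker_exchange_assoc, switchCell, reassoc_of% h1,
      ← BraidedCategory.braiding_naturality_left_assoc, h2, whiskerCell]
    simp only [Category.assoc]
  rw [← tensorHom_id, id_def, hom_tensor_hom]
  exact hom_eq_hom (ρ_ _) (ρ_ _) (ht _ _) (hs _ _)

end Learn

/-! ### Images of cells under a strong monoidal functor -/

namespace CompactClosed

section Conj

open Functor.LaxMonoidal Functor.OplaxMonoidal

variable {C : Type u₁} [Category.{v₁} C] [MonoidalCategory C]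
  {D : Type u₂} [Category.{v₂} D] [MonoidalCategory D] (F : C ⥤ D) [F.Monoidal]

/-- The image of a cell under `F`, conjugated by the structure isomorphisms of `F`. -/
def conj {P A Q B : C} (l : P ⊗ A ⟶ Q ⊗ B) : F.obj P ⊗ F.obj A ⟶ F.obj Q ⊗ F.obj B :=
  μ F P A ≫ F.map l ≫ δ F Q B

lemma conj_comp {P A Q B R E : C} (l : P ⊗ A ⟶ Q ⊗ B) (m : Q ⊗ B ⟶ R ⊗ E) :
    conj F (l ≫ m) = conj F l ≫ conj F m := by simp [conj]

lemma conj_whiskerRight {P Q : C} (p : P ⟶ Q) (A : C) :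
    conj F (p ▷ A) = F.map p ▷ F.obj A := by
  rw [conj, ← Functor.LaxMonoidal.μ_natural_left_assoc, Functor.Monoidal.μ_δ, Category.comp_id]

lemma conj_whiskerLeft {A B : C} (P : C) (f : A ⟶ B) :
    conj F (P ◁ f) = F.obj P ◁ F.map f := by
  rw [conj, ← Functor.LaxMonoidal.μ_natural_right_assoc, Functor.Monoidal.μ_δ, Category.comp_id]

variable [SymmetricCategory C] [SymmetricCategory D]

lemma conj_lwhisker (X : C) {P A Q B : C} (l : P ⊗ A ⟶ Q ⊗ B) :
    conj F (Cell.lwhisker X l) =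
      δ F X P ▷ F.obj A ≫ Cell.lwhisker (F.obj X) (conj F l) ≫ μ F X Q ▷ F.obj B := by
  simp only [conj, Cell.lwhisker, Functor.map_comp, Functor.Monoidal.map_whiskerLeft,
    Functor.Monoidal.map_associator, Functor.Monoidal.map_associator_inv, Category.assoc,
    Functor.Monoidal.μ_δ_assoc, Functor.Monoidal.μ_δ, Category.comp_id,
    MonoidalCategory.whiskerLeft_comp]

lemma conj_whiskerCell {P A Q B : C} (l : P ⊗ A ⟶ Q ⊗ B) (Y : C) :
    conj F (whiskerCell l Y) =
      F.obj P ◁ δ F A Y ≫ whiskerCell (conj F l) (F.obj Y) ≫ F.obj Q ◁ μ F B Y := by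
  simp only [conj, whiskerCell, Functor.map_comp, Functor.Monoidal.map_whiskerRight,
    Functor.Monoidal.map_associator, Functor.Monoidal.map_associator_inv, Category.assoc,
    Functor.Monoidal.μ_δ_assoc, Functor.Monoidal.μ_δ, Category.comp_id, comp_whiskerRight]

end Conj

section BraidedConj

open Functor.LaxMonoidal Functor.OplaxMonoidal

variable {C : Type u₁} [Category.{v₁} C] [MonoidalCategory C] [SymmetricCategory C]
  {D : Type u₂} [Category.{v₂} D] [MonoidalCategory D] [SymmetricCategory D]
  (F : C ⥤ D) [F.Braided]

/-- Compatibility of `F` with the symmetries enters here, since composition of cells swaps `P₂` past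
`Q₁`. -/
lemma conj_cellComp {P₁ A Q₁ B P₂ Q₂ E : C} (l₁ : P₁ ⊗ A ⟶ Q₁ ⊗ B) (l₂ : P₂ ⊗ B ⟶ Q₂ ⊗ E) :
    conj F (Cell.comp l₁ l₂) =
      δ F P₂ P₁ ▷ F.obj A ≫ Cell.comp (conj F l₁) (conj F l₂) ≫ μ F Q₁ Q₂ ▷ F.obj E := by
  simp only [Cell.comp, conj_comp, conj_lwhisker, conj_whiskerRight, Functor.map_braiding,
    Category.assoc, comp_whiskerRight]
  simp only [← comp_whiskerRight_assoc, Functor.Monoidal.μ_δ, Category.comp_id]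
  simp

lemma conj_switchCell {P A Q B : C} (r : Q ⊗ B ⟶ P ⊗ A) (Y : C) :
    conj F (switchCell r Y) =
      F.obj Q ◁ δ F Y B ≫ switchCell (conj F r) (F.obj Y) ≫ F.obj P ◁ μ F Y A := by
  simp only [conj, switchCell, Functor.map_comp, Functor.Monoidal.map_whiskerLeft,
    Functor.Monoidal.map_whiskerRight, Functor.Monoidal.map_associator,
    Functor.Monoidal.map_associator_inv, Functor.map_braiding, Category.assoc,
    Functor.Monoidal.μ_δ_assoc, Functor.Monoidal.μ_δ, Category.comp_id, comp_whiskerRight,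
    MonoidalCategory.whiskerLeft_comp, Functor.Monoidal.whiskerRight_μ_δ_assoc]

end BraidedConj

/-! ### The functor on learners and its symmetric monoidal structure -/

section

variable {C : Type u₁} [Category.{v₁} C] [MonoidalCategory C] [SymmetricCategory C]
  {D : Type u₂} [Category.{v₂} D] [MonoidalCategory D] [SymmetricCategory D]
  [RightRigidCategory D] (F : C ⥤ D) [F.Braided]

open Functor.LaxMonoidal Functor.OplaxMonoidal

lemma fhatMap_eq {A A' B B' P Q : C} (l : P ⊗ A ⟶ Q ⊗ B) (r : Q ⊗ B' ⟶ P ⊗ A') :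
    fhatMap F l r = contract (conj F l)
      (mate ((F.obj A')ᘁ ⊗ (F.obj P)ᘁ) ((F.obj B')ᘁ ⊗ (F.obj Q)ᘁ) (conj F r)) := by
  simp only [fhatMap, contract, insertPair, cancelPair, cup, MonoidalCategory.whiskerLeft_comp,
    Category.assoc]
  -- `mateTensor` unfolds to `mate` for the tensor pairings of the chosen duals.
  rfl

lemma fhatMap_slide {A A' B B' P P' Q Q' : C} (p : P ⟶ P') (q : Q ⟶ Q')
    (l : P' ⊗ A ⟶ Q ⊗ B) (r : Q' ⊗ B' ⟶ P ⊗ A') :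
    fhatMap F (p ▷ A ≫ l) (q ▷ B' ≫ r) = fhatMap F (l ≫ q ▷ B) (r ≫ p ▷ A') := by
  simp only [fhatMap_eq, conj_comp, conj_whiskerRight]
  exact contract_mate_slide _ _ _ _

lemma fhatMap_comp {A A' B B' E E' P₁ Q₁ P₂ Q₂ : C}
    (l₁ : P₁ ⊗ A ⟶ Q₁ ⊗ B) (r₁ : Q₁ ⊗ B' ⟶ P₁ ⊗ A')
    (l₂ : P₂ ⊗ B ⟶ Q₂ ⊗ E) (r₂ : Q₂ ⊗ E' ⟶ P₂ ⊗ B') :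
    fhatMap F (Cell.comp l₁ l₂) (Cell.comp r₂ r₁) = fhatMap F l₁ r₁ ≫ fhatMap F l₂ r₂ := by
  simp only [fhatMap_eq, conj_cellComp]
  rw [← contract_comp, ← mate_comp_cell]
  -- The structure isomorphisms left over by `conj_cellComp` only change the residuals.
  exact contract_mate_iso (Functor.Monoidal.μIso F P₂ P₁).symm (Functor.Monoidal.μIso F Q₁ Q₂).symm
    _ _

lemma fhatMap_ofPair {A A' B B' : C} (f : A ⟶ B) (g : B' ⟶ A') :
    fhatMap F (𝟙_ C ◁ f) (𝟙_ C ◁ g) = mate (F.obj A')ᘁ (F.obj B')ᘁ (F.map g) ⊗ₘ F.map f := by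
  rw [fhatMap_eq, conj_whiskerLeft, conj_whiskerLeft, mate_whiskerLeft,
    contract_wire (Functor.Monoidal.εIso F).symm]

/-- The functor on learners induced by `F`. -/
def learnFunctor : Learn C ⥤ D where
  obj X := (F.obj X.snd)ᘁ ⊗ F.obj X.fst
  map {X Y} := Quot.lift (fun a => fhatMap F a.l a.r) (by
    rintro _ _ ⟨p, q, l, r⟩
    exact fhatMap_slide F p q l r)
  map_id X := by
    rw [← Learn.ofPair_id]
    refine (fhatMap_ofPair F _ _).trans ?_
    rw [F.map_id, F.map_id, mate_id]; simp
  map_comp f g := by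
    induction f using Learn.hom_ind with | h P₁ Q₁ l₁ r₁ => ?_
    induction g using Learn.hom_ind with | h P₂ Q₂ l₂ r₂ => ?_
    exact fhatMap_comp F l₁ r₁ l₂ r₂

lemma learnFunctor_map_ofPair {X Y : Learn C} (f : X.fst ⟶ Y.fst) (g : Y.snd ⟶ X.snd) :
    (learnFunctor F).map (Learn.ofPair f g : X ⟶ Y) =
      mate (F.obj X.snd)ᘁ (F.obj Y.snd)ᘁ (F.map g) ⊗ₘ F.map f :=
  fhatMap_ofPair F f g

/-- The chosen dual of `F.obj A`. -/
abbrev fdual (A : C) : D := (F.obj A)ᘁ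

/-- The mate of a morphism between values of `F`. -/
abbrev fmate {A B : C} (f : F.obj A ⟶ F.obj B) : fdual F B ⟶ fdual F A :=
  mate (fdual F B) (fdual F A) f

/-- The dual of the structure isomorphism of `F`, with `X* ⊗ Y*` as the dual of `Y ⊗ X`. -/
def dualμ (Y X : C) : fdual F X ⊗ fdual F Y ≅ fdual F (Y ⊗ X) :=
  mateIso _ _ (Functor.Monoidal.μIso F Y X).symm

lemma dualμ_hom (Y X : C) : (dualμ F Y X).hom =
  mate (fdual F X ⊗ fdual F Y) (fdual F (Y ⊗ X)) (δ F Y X) := rfl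

lemma dualμ_inv (Y X : C) : (dualμ F Y X).inv =
  mate (fdual F (Y ⊗ X)) (fdual F X ⊗ fdual F Y) (μ F Y X) := rfl

/-- The dual of the unit isomorphism of `F`. -/
def dualε : 𝟙_ D ≅ fdual F (𝟙_ C) := mateIso _ _ (Functor.Monoidal.εIso F).symm

lemma dualε_hom : (dualε F).hom = mate (𝟙_ D) (fdual F (𝟙_ C)) (η F) := rfl

lemma dualε_inv : (dualε F).inv = mate (fdual F (𝟙_ C)) (𝟙_ D) (ε F) := rfl

/-- Every map involved is a mate, so by contravariance the identity is the mate of the compatibility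
of `F` with the symmetry. Associativity and unitality of `dualμ` follow in the same way. -/
lemma dualμ_braided (A B : C) : (dualμ F B A).hom ≫ fmate F (F.map (β_ A B).hom) =
    (β_ (fdual F A) (fdual F B)).hom ≫ (dualμ F A B).hom := by
  rw [dualμ_hom, dualμ_hom, ← mate_comp, ← mate_braiding_hom (X := F.obj A) (Y := F.obj B),
    ← mate_comp]
  simp [Functor.map_braiding]

lemma dualμ_associativity (A B E : C) :
    (dualμ F B A).hom ▷ fdual F E ≫ (dualμ F E (B ⊗ A)).hom ≫ fmate F (F.map (α_ E B A).hom) =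
      (α_ _ _ _).hom ≫ fdual F A ◁ (dualμ F E B).hom ≫ (dualμ F (E ⊗ B) A).hom := by
  simp only [dualμ_hom]
  rw [← mate_whiskerLeft (Z := F.obj E), ← mate_whiskerRight (Z := F.obj A),
    ← mate_associator_hom (X := F.obj E) (Y := F.obj B) (Z := F.obj A), ← mate_comp, ← mate_comp,
    ← mate_comp, ← mate_comp]
  simp

lemma dualμ_left_unitality (A : C) : (dualε F).hom ▷ fdual F A ≫ (dualμ F A (𝟙_ C)).hom ≫
    fmate F (F.map (ρ_ A).inv) = (λ_ (fdual F A)).hom := by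
  rw [dualμ_hom, dualε_hom, ← mate_whiskerLeft (Z := F.obj A), ← mate_comp, ← mate_comp,
    ← mate_rightUnitor_inv (X := F.obj A)]
  simp

/-- The interchange isomorphism of the middle wires. -/
def interchange (X Y Z W : D) : (X ⊗ Y) ⊗ (Z ⊗ W) ≅ (X ⊗ Z) ⊗ (Y ⊗ W) where
  hom := tensorμ X Y Z W
  inv := tensorδ X Y Z W

/-- The tensorator of `learnFunctor`, in terms of the components of objects. -/
def fhatμ (A A' B B' : C) : (fdual F A' ⊗ F.obj A) ⊗ (fdual F B' ⊗ F.obj B) ≅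
    fdual F (B' ⊗ A') ⊗ F.obj (A ⊗ B) :=
  interchange (fdual F A') (F.obj A) (fdual F B') (F.obj B) ≪≫
    (dualμ F B' A' ⊗ᵢ Functor.Monoidal.μIso F A B)

lemma fhatμ_hom (A A' B B' : C) : (fhatμ F A A' B B').hom =
    tensorμ (fdual F A') (F.obj A) (fdual F B') (F.obj B) ≫ ((dualμ F B' A').hom ⊗ₘ μ F A B) := rfl

/-- The unit comparison of `learnFunctor`. -/
def fhatε : 𝟙_ D ≅ fdual F (𝟙_ C) ⊗ F.obj (𝟙_ C) :=
  (λ_ (𝟙_ D)).symm ≪≫ (dualε F ⊗ᵢ Functor.Monoidal.εIso F)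

lemma fhatε_hom : (fhatε F).hom = (λ_ (𝟙_ D)).inv ≫ ((dualε F).hom ⊗ₘ ε F) := rfl

/-- The isomorphisms `μ`, `δ` and their mates act on outer wires only, so `contract_wires` extracts
them; those at the source cancel and those at the target rebuild the tensorator. -/
lemma fhatμ_natural_left {A A' B B' P Q : C} (l : P ⊗ A ⟶ Q ⊗ B) (r : Q ⊗ B' ⟶ P ⊗ A')
    (E E' : C) : fhatMap F l r ▷ (fdual F E' ⊗ F.obj E) ≫ (fhatμ F B B' E E').hom =
      (fhatμ F A A' E E').hom ≫ fhatMap F (whiskerCell l E) (switchCell r E') := by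
  rw [fhatμ_hom, fhatμ_hom, fhatMap_eq, fhatMap_eq, conj_whiskerCell, conj_switchCell]
  rw [mate_comp (Y' := (fdual F B' ⊗ fdual F E') ⊗ fdual F Q),
    mate_comp (Y' := (fdual F A' ⊗ fdual F E') ⊗ fdual F P),
    mate_switchCell, mate_whiskerLeft, mate_whiskerLeft]
  simp only [Category.assoc]
  rw [contract_wires, reassoc_of% @contract_whiskerRight, tensorHom_comp_tensorHom_assoc,
    ← dualμ_inv, Iso.hom_inv_id, Functor.Monoidal.μ_δ, id_tensorHom_id, Category.id_comp, dualμ_hom]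

lemma fhatμ_braided (A A' B B' : C) :
    (fhatμ F A A' B B').hom ≫ (fmate F (F.map (β_ A' B').hom) ⊗ₘ F.map (β_ A B).hom) =
      (β_ _ _).hom ≫ (fhatμ F B B' A A').hom := by
  rw [fhatμ_hom, fhatμ_hom, Category.assoc, tensorHom_comp_tensorHom, dualμ_braided,
    Functor.LaxBraided.braided, ← tensorHom_comp_tensorHom, reassoc_of% @Cell.tensorμ_braiding]

lemma fhatμ_associativity (A A' B B' E E' : C) :
    (fhatμ F A A' B B').hom ▷ (fdual F E' ⊗ F.obj E) ≫ (fhatμ F (A ⊗ B) (B' ⊗ A') E E').hom ≫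
      (fmate F (F.map (α_ E' B' A').hom) ⊗ₘ F.map (α_ A B E).hom) =
    (α_ _ _ _).hom ≫ (fdual F A' ⊗ F.obj A) ◁ (fhatμ F B B' E E').hom ≫
      (fhatμ F A A' (B ⊗ E) (E' ⊗ B')).hom := by
  simp only [fhatμ_hom, comp_whiskerRight, MonoidalCategory.whiskerLeft_comp, Category.assoc,
    tensorμ_natural_left_assoc, tensorμ_natural_right_assoc, tensorHom_comp_tensorHom,
    dualμ_associativity, Functor.LaxMonoidal.associativity]
  rw [← tensorHom_comp_tensorHom, reassoc_of% @tensor_associativity]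

lemma fhatμ_left_unitality (A A' : C) : (λ_ (fdual F A' ⊗ F.obj A)).hom =
    (fhatε F).hom ▷ (fdual F A' ⊗ F.obj A) ≫ (fhatμ F (𝟙_ C) (𝟙_ C) A A').hom ≫
      (fmate F (F.map (ρ_ A').inv) ⊗ₘ F.map (λ_ A).hom) := by
  simp only [fhatμ_hom, fhatε_hom, comp_whiskerRight, Category.assoc,
    tensorμ_natural_left_assoc, tensorHom_comp_tensorHom, dualμ_left_unitality]
  rw [← Functor.LaxMonoidal.left_unitality, tensor_left_unitality]

/-- The tensorator of `learnFunctor`. -/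
def learnμ (X Y : Learn C) : (learnFunctor F).obj X ⊗ (learnFunctor F).obj Y ≅
    (learnFunctor F).obj (X ⊗ Y) :=
  fhatμ F X.fst X.snd Y.fst Y.snd

/-- The unit comparison of `learnFunctor`. -/
def learnε : 𝟙_ D ≅ (learnFunctor F).obj (𝟙_ (Learn C)) := fhatε F

lemma learnμ_natural_left {X Y : Learn C} (f : X ⟶ Y) (Z : Learn C) :
    (learnFunctor F).map f ▷ (learnFunctor F).obj Z ≫ (learnμ F Y Z).hom =
      (learnμ F X Z).hom ≫ (learnFunctor F).map (f ▷ Z) := by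
  induction f using Learn.hom_ind with | h P Q l r => ?_
  rw [Learn.hom_whiskerRight]
  exact fhatμ_natural_left F l r Z.fst Z.snd

lemma learnμ_braided (X Y : Learn C) :
    (learnμ F X Y).hom ≫ (learnFunctor F).map (β_ X Y).hom = (β_ _ _).hom ≫ (learnμ F Y X).hom :=
  (congrArg ((learnμ F X Y).hom ≫ ·) (learnFunctor_map_ofPair F _ _)).trans
    (fhatμ_braided F X.fst X.snd Y.fst Y.snd)

/-- Conjugating by the symmetry reduces the claim to naturality in the left variable; right
unitality is obtained from left unitality by the same device. -/
lemma learnμ_natural_right {X Y : Learn C} (Z : Learn C) (f : X ⟶ Y) :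
    (learnFunctor F).obj Z ◁ (learnFunctor F).map f ≫ (learnμ F Z Y).hom =
      (learnμ F Z X).hom ≫ (learnFunctor F).map (Z ◁ f) := by
  rw [← cancel_epi (β_ _ _).hom, ← BraidedCategory.braiding_naturality_left_assoc,
    ← learnμ_braided, reassoc_of% @learnμ_natural_left, ← Functor.map_comp,
    BraidedCategory.braiding_naturality_left, Functor.map_comp, reassoc_of% @learnμ_braided]

lemma learnμ_associativity (X Y Z : Learn C) :
    (learnμ F X Y).hom ▷ (learnFunctor F).obj Z ≫ (learnμ F (X ⊗ Y) Z).hom ≫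
      (learnFunctor F).map (α_ X Y Z).hom =
    (α_ _ _ _).hom ≫ (learnFunctor F).obj X ◁ (learnμ F Y Z).hom ≫ (learnμ F X (Y ⊗ Z)).hom :=
  (congrArg (fun k => (learnμ F X Y).hom ▷ (learnFunctor F).obj Z ≫ (learnμ F (X ⊗ Y) Z).hom ≫ k)
    (learnFunctor_map_ofPair F _ _)).trans
    (fhatμ_associativity F X.fst X.snd Y.fst Y.snd Z.fst Z.snd)

lemma learnμ_left_unitality (X : Learn C) : (λ_ ((learnFunctor F).obj X)).hom =
    (learnε F).hom ▷ (learnFunctor F).obj X ≫ (learnμ F (𝟙_ (Learn C)) X).hom ≫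
      (learnFunctor F).map (λ_ X).hom :=
  (fhatμ_left_unitality F X.fst X.snd).trans
    (congrArg (fun k => (learnε F).hom ▷ (learnFunctor F).obj X ≫
      (learnμ F (𝟙_ (Learn C)) X).hom ≫ k) (learnFunctor_map_ofPair F _ _)).symm

lemma learnμ_right_unitality (X : Learn C) : (ρ_ ((learnFunctor F).obj X)).hom =
    (learnFunctor F).obj X ◁ (learnε F).hom ≫ (learnμ F X (𝟙_ (Learn C))).hom ≫
      (learnFunctor F).map (ρ_ X).hom := by
  rw [← cancel_epi (β_ (𝟙_ D) _).hom, braiding_rightUnitor, learnμ_left_unitality,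
    ← BraidedCategory.braiding_naturality_left_assoc, ← reassoc_of% @learnμ_braided,
    ← Functor.map_comp, braiding_rightUnitor]

instance : (learnFunctor F).Braided where
  toMonoidal := Functor.CoreMonoidal.toMonoidal
    { εIso := learnε F
      μIso := learnμ F
      μIso_hom_natural_left := learnμ_natural_left F
      μIso_hom_natural_right := learnμ_natural_right F
      associativity := learnμ_associativity F
      left_unitality := learnμ_left_unitality F
      right_unitality := learnμ_right_unitality F }
  braided := learnμ_braided F

end

end CompactClosed

/-! ### Images of cups, caps and snakes -/

namespace CompactClosed

section

variable {D : Type u} [Category.{v} D] [MonoidalCategory D] [SymmetricCategory D]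

/-- With a trivial created pair, both components merely rename the wires `W` and `W'` as residuals,
which are then cancelled. The cup is the reverse situation. -/
lemma contract_cap (W W' : D) [ExactPairing W W'] :
    contract ((λ_ W).hom ≫ (ρ_ W).inv) ((ρ_ W').hom ≫ (λ_ W').inv) =
      ε_ W W' ≫ (λ_ (𝟙_ D)).inv := by
  simp only [contract, insertPair, cancelPair, cup_unit]
  monoidal

lemma contract_cup (W W' : D) [ExactPairing W W'] :
    contract ((ρ_ W).hom ≫ (λ_ W).inv) ((λ_ W').hom ≫ (ρ_ W').inv) =
      (λ_ (𝟙_ D)).hom ≫ cup W W' := by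
  simp only [contract, insertPair, cancelPair, unit_evaluation]
  monoidal

/-- The exact pairing of `A₁' ⊗ A` and `A' ⊗ A₁`, for duals `A'` and `A₁'` of `A` and `A₁`. -/
@[reducible]
def pairPairing (A A' A₁ A₁' : D) [ExactPairing A A'] [ExactPairing A₁ A₁'] :
    ExactPairing (A₁' ⊗ A) (A' ⊗ A₁) :=
  letI := BraidedCategory.exactPairing_swap A₁ A₁'
  ExactPairing.tensor

/-- The middle interchange supplies the crossing of `A₁` with `A₁'` that defines the reversed
evaluation in `pairPairing`. -/
lemma tensorμ_evaluation (A A' A₁ A₁' : D) [ExactPairing A A'] [ExactPairing A₁ A₁'] :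
    tensorμ A' A₁ A₁' A ≫ ε_ (A₁ ⊗ A) (A' ⊗ A₁') =
      (pairPairing A A' A₁ A₁').evaluation' := by
  change _ = 𝟙 _ ⊗≫ A' ◁ (((β_ A₁ A₁').hom ≫ ε_ A₁ A₁') ▷ A) ⊗≫ ε_ A A'
  simp only [tensorμ, ExactPairing.tensor_evaluation]
  monoidal

/-- The crossing of `A` with `A'` built into `cup` is undone by the interchange; the one on `A₁`
survives and, by symmetry, equals the inverse braiding of the reversed pairing. -/
lemma cup_tensorδ (A A' A₁ A₁' : D) [ExactPairing A A'] [ExactPairing A₁ A₁'] :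
    cup (A ⊗ A₁) (A₁' ⊗ A') ≫ tensorδ A₁' A A' A₁ =
      (pairPairing A A' A₁ A₁').coevaluation' := by
  change _ = (η_ A₁ A₁' ≫ (β_ A₁' A₁).inv) ⊗≫ (A₁' ◁ η_ A A') ▷ A₁ ⊗≫ 𝟙 _
  rw [cup_tensor, ← SymmetricCategory.braiding_swap_eq_inv_braiding]
  simp only [tensorδ]
  calc
    _ = cup A₁ A₁' ⊗≫ A₁' ◁ (η_ A A' ≫ (β_ A A').hom ≫ (β_ A A').inv) ▷ A₁ ⊗≫ 𝟙 _ := by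
      simp only [cup]; monoidal
    _ = _ := by rw [Iso.hom_inv_id, Category.comp_id, cup]; monoidal

end

section

variable {C : Type u₁} [Category.{v₁} C] [MonoidalCategory C] [SymmetricCategory C]
  {D : Type u₂} [Category.{v₂} D] [MonoidalCategory D] [SymmetricCategory D]
  [RightRigidCategory D] (F : C ⥤ D) [F.Braided]

open Functor.LaxMonoidal Functor.OplaxMonoidal

lemma conj_leftUnitor_rightUnitor (W : C) : conj F ((λ_ W).hom ≫ (ρ_ W).inv) =
    η F ▷ F.obj W ≫ ((λ_ (F.obj W)).hom ≫ (ρ_ (F.obj W)).inv) ≫ F.obj W ◁ ε F := by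
  simp [conj]

lemma conj_rightUnitor_leftUnitor (W : C) : conj F ((ρ_ W).hom ≫ (λ_ W).inv) =
    F.obj W ◁ η F ≫ ((ρ_ (F.obj W)).hom ≫ (λ_ (F.obj W)).inv) ≫ ε F ▷ F.obj W := by
  simp [conj]

lemma mate_unitors {W W' : D} [ExactPairing W W'] :
    mate (W' ⊗ 𝟙_ D) (𝟙_ D ⊗ W') ((ρ_ W).hom ≫ (λ_ W).inv) = (ρ_ W').hom ≫ (λ_ W').inv := by
  rw [mate_comp (Y' := W'), mate_rightUnitor_hom, mate_leftUnitor_inv]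

lemma mate_unitors' {W W' : D} [ExactPairing W W'] :
    mate (𝟙_ D ⊗ W') (W' ⊗ 𝟙_ D) ((λ_ W).hom ≫ (ρ_ W).inv) = (λ_ W').hom ≫ (ρ_ W').inv := by
  rw [mate_comp (Y' := W'), mate_leftUnitor_hom, mate_rightUnitor_inv]

lemma fhatMap_cap (W : C) :
    fhatMap F ((λ_ W).hom ≫ (ρ_ W).inv) ((ρ_ W).hom ≫ (λ_ W).inv) =
      ε_ (F.obj W) (fdual F W) ≫ (fhatε F).hom := by
  -- The residual `FI` is replaced by the unit of `D`; the remaining unit isomorphisms sit on outer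
  -- wires, are extracted by `contract_wires`, and assemble into `fhatε`.
  have h := contract_mate_iso (P' := fdual F (𝟙_ C)) (Q' := fdual F W) (R' := 𝟙_ D)
    (S' := fdual F W) (A' := fdual F W) (B' := fdual F (𝟙_ C)) (Functor.Monoidal.εIso F).symm
    (Iso.refl (F.obj W)) (((λ_ (F.obj W)).hom ≫ (ρ_ (F.obj W)).inv) ≫ F.obj W ◁ ε F)
    (F.obj W ◁ η F ≫ ((ρ_ (F.obj W)).hom ≫ (λ_ (F.obj W)).inv))
  simp only [Iso.symm_hom, Functor.Monoidal.εIso_inv, Functor.Monoidal.εIso_hom, Iso.symm_inv,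
    Iso.refl_hom, Iso.refl_inv, id_whiskerRight, Category.id_comp, Category.comp_id,
    Category.assoc] at h
  rw [fhatMap_eq, conj_leftUnitor_rightUnitor, conj_rightUnitor_leftUnitor]
  simp only [Category.assoc]
  refine h.trans ?_
  have h2 := contract_wires (P' := 𝟙_ D) (Q' := fdual F W) (𝟙 (F.obj W)) (𝟙 (fdual F W)) (ε F)
    (dualε F).hom ((λ_ (F.obj W)).hom ≫ (ρ_ (F.obj W)).inv)
    ((ρ_ (fdual F W)).hom ≫ (λ_ (fdual F W)).inv)
  rw [contract_cap] at h2
  rw [mate_comp (Y' := 𝟙_ D ⊗ fdual F W), mate_unitors, mate_whiskerLeft, ← dualε_hom]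
  simpa [fhatε_hom] using h2

lemma fhatMap_cup (W : C) :
    fhatMap F ((ρ_ W).hom ≫ (λ_ W).inv) ((λ_ W).hom ≫ (ρ_ W).inv) =
      (fhatε F).inv ≫ cup (F.obj W) (fdual F W) := by
  have h := contract_mate_iso (P' := fdual F W) (Q' := fdual F (𝟙_ C)) (R' := fdual F W)
    (S' := 𝟙_ D) (A' := fdual F (𝟙_ C)) (B' := fdual F W) (Iso.refl (F.obj W))
    (Functor.Monoidal.εIso F).symm
    (F.obj W ◁ η F ≫ ((ρ_ (F.obj W)).hom ≫ (λ_ (F.obj W)).inv))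
    (((λ_ (F.obj W)).hom ≫ (ρ_ (F.obj W)).inv) ≫ F.obj W ◁ ε F)
  simp only [Iso.symm_hom, Functor.Monoidal.εIso_inv, Functor.Monoidal.εIso_hom, Iso.symm_inv,
    Iso.refl_hom, Iso.refl_inv, id_whiskerRight, Category.id_comp, Category.comp_id,
    Category.assoc] at h
  rw [fhatMap_eq, conj_leftUnitor_rightUnitor, conj_rightUnitor_leftUnitor]
  simp only [Category.assoc]
  refine h.trans ?_
  have h2 := contract_wires (P' := fdual F W) (Q' := 𝟙_ D) (η F) (dualε F).inv (𝟙 (F.obj W))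
    (𝟙 (fdual F W)) ((ρ_ (F.obj W)).hom ≫ (λ_ (F.obj W)).inv)
    ((λ_ (fdual F W)).hom ≫ (ρ_ (fdual F W)).inv)
  rw [contract_cup] at h2
  rw [← Category.assoc (λ_ (F.obj W)).hom, mate_comp (Y' := 𝟙_ D ⊗ fdual F W), mate_unitors',
    mate_whiskerLeft, ← dualε_inv]
  simpa [fhatε] using h2

/-- The dual half of the tensorator is the mate of `δ`. It slides through the evaluation and cancels
against `μ`; `fhatμ_cup` is the same argument through `cup_mate`. -/
lemma fhatμ_cap (A A' : C) : (fhatμ F A' A A A').hom ≫ ε_ (F.obj (A' ⊗ A)) (fdual F (A' ⊗ A)) =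
    (pairPairing (F.obj A) (fdual F A) (F.obj A') (fdual F A')).evaluation' := by
  rw [← tensorμ_evaluation, fhatμ_hom, Category.assoc, MonoidalCategory.tensorHom_def', dualμ_hom,
    Category.assoc, mate_evaluation, ← MonoidalCategory.whiskerLeft_comp_assoc,
    Functor.Monoidal.μ_δ, MonoidalCategory.whiskerLeft_id, Category.id_comp]

lemma fhatμ_cup (A A' : C) : cup (F.obj (A ⊗ A')) (fdual F (A ⊗ A')) ≫ (fhatμ F A A' A' A).inv =
    (pairPairing (F.obj A) (fdual F A) (F.obj A') (fdual F A')).coevaluation' := by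
  rw [← cup_tensorδ, Iso.comp_inv_eq, Category.assoc, fhatμ_hom, tensorδ_tensorμ_assoc]
  rw [MonoidalCategory.tensorHom_def, dualμ_hom, reassoc_of% @cup_mate,
    ← MonoidalCategory.whiskerLeft_comp, Functor.Monoidal.δ_μ, MonoidalCategory.whiskerLeft_id,
    Category.comp_id]

lemma learnFunctor_map_cap (X : Learn C) :
    μ (learnFunctor F) (Learn.dual X) X ≫ (learnFunctor F).map (Learn.cap X) ≫ η (learnFunctor F) =
      (pairPairing (F.obj X.fst) (fdual F X.fst) (F.obj X.snd) (fdual F X.snd)).evaluation' := by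
  have h : (learnFunctor F).map (Learn.cap X) =
      ε_ (F.obj (X.snd ⊗ X.fst)) (fdual F (X.snd ⊗ X.fst)) ≫ (fhatε F).hom := fhatMap_cap F _
  rw [← fhatμ_cap, h]
  change (fhatμ F X.snd X.fst X.fst X.snd).hom ≫ (ε_ _ _ ≫ (fhatε F).hom) ≫ (fhatε F).inv = _
  simp

lemma learnFunctor_map_cup (X : Learn C) :
    ε (learnFunctor F) ≫ (learnFunctor F).map (Learn.cup X) ≫ δ (learnFunctor F) X (Learn.dual X) =
      (pairPairing (F.obj X.fst) (fdual F X.fst) (F.obj X.snd) (fdual F X.snd)).coevaluation' := by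
  have h : (learnFunctor F).map (Learn.cup X) =
      (fhatε F).inv ≫ cup (F.obj (X.fst ⊗ X.snd)) (fdual F (X.fst ⊗ X.snd)) := fhatMap_cup F _
  rw [← fhatμ_cup, h]
  change (fhatε F).hom ≫ ((fhatε F).inv ≫ cup _ _) ≫ (fhatμ F X.fst X.snd X.snd X.fst).inv = _
  simp

/-- Strong monoidality turns the image of the snake into a snake on the transported cup and cap,
which form `pairPairing`; its zigzag identity finishes. -/
lemma learnFunctor_map_snake (X : Learn C) : (learnFunctor F).map (Learn.snake X) = 𝟙 _ := by
  have h : (learnFunctor F).map (Learn.snake X) = (λ_ _).inv ≫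
      (ε (learnFunctor F) ≫ (learnFunctor F).map (Learn.cup X) ≫
        δ (learnFunctor F) X (Learn.dual X)) ▷ (learnFunctor F).obj X ≫ (α_ _ _ _).hom ≫
      (learnFunctor F).obj X ◁ (μ (learnFunctor F) (Learn.dual X) X ≫
        (learnFunctor F).map (Learn.cap X) ≫ η (learnFunctor F)) ≫ (ρ_ _).hom := by
    simp only [Learn.snake, Functor.map_comp, Functor.Monoidal.map_leftUnitor_inv,
      Functor.Monoidal.map_rightUnitor, Functor.Monoidal.map_whiskerLeft,
      Functor.Monoidal.map_whiskerRight, Functor.Monoidal.map_associator, Category.assoc,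
      Functor.Monoidal.μ_δ_assoc, comp_whiskerRight, MonoidalCategory.whiskerLeft_comp]
  have h2 := (pairPairing (F.obj X.fst) (fdual F X.fst) (F.obj X.snd)
    (fdual F X.snd)).evaluation_coevaluation'
  rw [h, learnFunctor_map_cap, learnFunctor_map_cup]
  have h3 := congrArg (fun k => (λ_ _).inv ≫ k ≫ (ρ_ _).hom) h2
  simp only [Category.assoc, Iso.inv_hom_id_assoc, Iso.inv_hom_id] at h3
  exact h3

/-- The kernel of a strong monoidal functor is a monoidal congruence, so only the snake generators
need an argument. -/
lemma learnFunctor_map_eq {X Y : Learn C} {f g : X ⟶ Y} (h : Learn.AtempRel f g) :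
    (learnFunctor F).map f = (learnFunctor F).map g := by
  induction h with
  | snake X => rw [learnFunctor_map_snake, CategoryTheory.Functor.map_id]
  | refl f => rfl
  | symm _ h => exact h.symm
  | trans _ _ h h' => exact h.trans h'
  | comp _ _ h h' => rw [Functor.map_comp, Functor.map_comp, h, h']
  | tensor _ _ h h' => rw [Functor.Monoidal.map_tensor, Functor.Monoidal.map_tensor, h, h']

/-! ### Descent to atemporal learners -/

/-- The functor on atemporal learners induced by `F`. -/
def atempFunctor : Atemp C ⥤ D :=
  CategoryTheory.Quotient.lift _ (learnFunctor F) (fun _ _ _ _ h => learnFunctor_map_eq F h)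

/-- Quotienting changes neither the tensor of objects nor the coherence maps, and every morphism
lifts to a learner, so the structure of `learnFunctor` descends unchanged. -/
instance : (atempFunctor F).Braided where
  toMonoidal := Functor.CoreMonoidal.toMonoidal
    { εIso := learnε F
      μIso := fun X Y => learnμ F X.as Y.as
      μIso_hom_natural_left := fun f Z => by
        induction f using Atemp.ind with | h f => ?_
        exact learnμ_natural_left F f Z.as
      μIso_hom_natural_right := fun Z f => by
        induction f using Atemp.ind with | h f => ?_
        exact learnμ_natural_right F Z.as f
      associativity := fun X Y Z => learnμ_associativity F X.as Y.as Z.as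
      left_unitality := fun X => learnμ_left_unitality F X.as
      right_unitality := fun X => learnμ_right_unitality F X.as }
  braided X Y := learnμ_braided F X.as Y.as

/-! ### Factorization of the original functor -/

/-- The component `(F I)* ⊗ F A ≅ F A` of the factorization of `F` through `Atemp.ι C`. -/
def factorIso (A : C) : fdual F (𝟙_ C) ⊗ F.obj A ≅ F.obj A :=
  whiskerRightIso (dualε F).symm (F.obj A) ≪≫ λ_ (F.obj A)

lemma factorIso_hom (A : C) :
    (factorIso F A).hom = (dualε F).inv ▷ F.obj A ≫ (λ_ (F.obj A)).hom := rfl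

lemma factorIso_naturality {A B : C} (f : A ⟶ B) :
    (fmate F (F.map (𝟙 (𝟙_ C))) ⊗ₘ F.map f) ≫ (factorIso F B).hom =
      (factorIso F A).hom ≫ F.map f := by
  rw [fmate, F.map_id, mate_id, id_tensorHom, factorIso_hom, factorIso_hom,
    whisker_exchange_assoc, Category.assoc, leftUnitor_naturality]

/-- `F` factors through `Atemp.ι C`. -/
def factorNatIso : Atemp.ι C ⋙ atempFunctor F ≅ F :=
  NatIso.ofComponents (factorIso F) (fun {_ B} f =>
    (congrArg (· ≫ (factorIso F B).hom) ((congrArg (learnFunctor F).map (Learn.incl_map f)).trans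
      (learnFunctor_map_ofPair F _ _))).trans (factorIso_naturality F f))

/-- Mate of the unitality of `F` at the unit object. It merges the two spare wires `(FI)*` of a
tensor product into one, as monoidality of the factorization requires. -/
lemma dualμ_unit : (dualμ F (𝟙_ C) (𝟙_ C)).hom ≫ fmate F (F.map (λ_ (𝟙_ C)).inv) ≫
    (dualε F).inv = ((dualε F).inv ⊗ₘ (dualε F).inv) ≫ (λ_ (𝟙_ D)).hom := by
  rw [dualμ_hom, dualε_inv, ← mate_tensor, unitors_equal, ← mate_leftUnitor_inv (X := 𝟙_ D),
    ← mate_comp, ← mate_comp, ← mate_comp, Functor.Monoidal.map_leftUnitor_inv]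
  simp [MonoidalCategory.tensorHom_def']

lemma fhatε_factorIso : (fhatε F).hom ≫ (factorIso F (𝟙_ C)).hom = ε F := by
  rw [fhatε_hom, factorIso_hom, MonoidalCategory.tensorHom_def', Category.assoc, Category.assoc,
    ← comp_whiskerRight_assoc, Iso.hom_inv_id, id_whiskerRight, Category.id_comp,
    leftUnitor_naturality, Iso.inv_hom_id_assoc]

/-- After the wires `(FI)*` are trivialized by `dualμ_unit`, the interchange becomes one between
unit wires, which is coherence for the left unitor. -/
lemma fhatμ_factorIso (A B : C) : (fhatμ F A (𝟙_ C) B (𝟙_ C)).hom ≫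
    (fmate F (F.map (λ_ (𝟙_ C)).inv) ⊗ₘ F.map (𝟙 (A ⊗ B))) ≫ (factorIso F (A ⊗ B)).hom =
      ((factorIso F A).hom ⊗ₘ (factorIso F B).hom) ≫ μ F A B := by
  have h : ((dualμ F (𝟙_ C) (𝟙_ C)).hom ⊗ₘ μ F A B) ≫
      (fmate F (F.map (λ_ (𝟙_ C)).inv) ▷ F.obj (A ⊗ B)) ≫ (dualε F).inv ▷ F.obj (A ⊗ B) =
      ((dualε F).inv ⊗ₘ (dualε F).inv) ▷ (F.obj A ⊗ F.obj B) ≫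
        (λ_ (𝟙_ D)).hom ▷ (F.obj A ⊗ F.obj B) ≫ 𝟙_ D ◁ μ F A B := by
    rw [← comp_whiskerRight_assoc, ← dualμ_unit, ← comp_whiskerRight,
      MonoidalCategory.tensorHom_def', Category.assoc, ← comp_whiskerRight,
      whisker_exchange]
  have h' := tensorμ_natural (dualε F).inv (𝟙 (F.obj A)) (dualε F).inv (𝟙 (F.obj B))
  rw [tensorHom_id, tensorHom_id, id_tensorHom_id, tensorHom_id] at h'
  rw [fhatμ_hom, F.map_id, tensorHom_id, factorIso_hom, Category.assoc, reassoc_of% h,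
    leftUnitor_naturality, ← reassoc_of% h', factorIso_hom, factorIso_hom,
    ← tensorHom_comp_tensorHom, leftUnitor_monoidal]
  simp only [Category.assoc]

lemma factorNatIso_isMonoidal : NatTrans.IsMonoidal (factorNatIso F).hom where
  unit := by
    -- Both the inclusion and the quotient functor have identity unit comparison.
    have h : ε (Atemp.ι C) = 𝟙 _ := (Category.id_comp _).trans ((Atemp.quot C).map_id _)
    refine (congrArg (fun k => (ε (atempFunctor F) ≫ (atempFunctor F).map k) ≫
      (factorNatIso F).hom.app (𝟙_ C)) h).trans ?_
    exact (congrArg (· ≫ (factorIso F (𝟙_ C)).hom) ((congrArg ((fhatε F).hom ≫ ·)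
      ((learnFunctor F).map_id _)).trans (Category.comp_id _))).trans (fhatε_factorIso F)
  tensor A B := by
    -- The quotient functor is strict, so only the tensorator of the inclusion remains.
    have h : μ (Atemp.ι C) A B = (Atemp.quot C).map (Learn.ofPair
        (X := (Learn.incl C).obj A ⊗ (Learn.incl C).obj B) (Y := (Learn.incl C).obj (A ⊗ B))
        (𝟙 (A ⊗ B)) (λ_ (𝟙_ C)).inv) :=
      Category.id_comp ((Atemp.quot C).map (Learn.ofPair
        (X := (Learn.incl C).obj A ⊗ (Learn.incl C).obj B) (Y := (Learn.incl C).obj (A ⊗ B))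
        (𝟙 (A ⊗ B)) (λ_ (𝟙_ C)).inv))
    refine (congrArg (fun k => (μ (atempFunctor F) _ _ ≫ (atempFunctor F).map k) ≫
      (factorNatIso F).hom.app (A ⊗ B)) h).trans ((Category.assoc _ _ _).trans ?_)
    exact (congrArg (fun k => (fhatμ F A (𝟙_ C) B (𝟙_ C)).hom ≫ k ≫ (factorIso F (A ⊗ B)).hom)
      (learnFunctor_map_ofPair F _ _)).trans (fhatμ_factorIso F A B)

end

end CompactClosed

theorem mainTheorem2 {C : Type u₁} [Category.{v₁} C] [MonoidalCategory C] [SymmetricCategory C]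
    {D : Type u₂} [Category.{v₂} D] [MonoidalCategory D] [SymmetricCategory D]
    [RightRigidCategory D] (F : C ⥤ D) [F.Braided] :
    ∃ (Fhat : Atemp C ⥤ D) (_ : Fhat.Braided)
      (hobj : ∀ A A' : C, Fhat.obj (Atemp.obj A A') = (F.obj A')ᘁ ⊗ F.obj A),
      (∀ {A A' B B' P Q : C} (l : P ⊗ A ⟶ Q ⊗ B) (r : Q ⊗ B' ⟶ P ⊗ A'),
        Fhat.map (Atemp.learner l r) =
          eqToHom (hobj A A') ≫ fhatMap F l r ≫ eqToHom (hobj B B').symm) ∧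
      ∃ e : Atemp.ι C ⋙ Fhat ≅ F, NatTrans.IsMonoidal e.hom := by
  exact ⟨CompactClosed.atempFunctor F, inferInstance, fun _ _ => rfl,
    -- The object equalities hold by `rfl`, so the transports along them are identities.
    fun _ _ => ((Category.id_comp _).trans (Category.comp_id _)).symm,
    CompactClosed.factorNatIso F, CompactClosed.factorNatIso_isMonoidal F⟩
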